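/- All Banach and Hilbert spaces are complex and all operators are bounded and linear; $B(X)$ is the algebra of operators on $X$. Let $\mathcal E(\mathbb T)=C^\infty(\mathbb T)$ be the Fréchet algebra of smooth functions on the unit circle (uniform convergence of derivatives of all orders). An operator $S\in B(Y)$ is *$\mathcal E(\mathbb T)$-scalar* if there is a continuous unital algebra homomorphism $\Phi:\mathcal E(\mathbb T)\to B(Y)$ with $\Phi(z)=S$; an operator is *$\mathcal E(\mathbb T)$-subscalar* if it is similar to the restriction of an $\mathcal E(\mathbb T)$-scalar operator on some Banach space to a closed invariant subspace. An operator $S\in B(Y)$ is an *extension* of $T\in B(X)$ if there is a linear isometry $\pi:X\to Y$ with $S\pi=\pi T$. For real $p\ge 1$, an *$SQ_p(X)$-space* is a Banach space isometric to a quotient of a closed subspace of an ultraproduct of spaces $L_p(\Omega,\mu,X)$ for some measure spaces $(\Omega,\mu)$. The spectrum of $S$ is $\sigma(S)$, and $\sigma_{ap}(T)$ is the set of $\lambda\in\mathbb C$ such that for every $\varepsilon>0$ there is a unit vector $x$ with $\|(T-\lambda)x\|<\varepsilon$. **Theorem.** (1) Let $X$ be a Banach space. An operator $T\in B(X)$ is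 $\mathcal E(\mathbb T)$-subscalar if and only if there exist constants $C>0$ and $s\ge 0$ such that $$\frac{1}{Cn^{s}}\|x\|\le\|T^nx\|\le Cn^{s}\|x\|\qquad(x\in X,\ n\ge 1).$$ Moreover, if $T$ satisfies this condition, then for every real $p\ge1$ there exist an $SQ_p(X)$-space $Y$, an invertible $\mathcal E(\mathbb T)$-scalar operator $S\in B(Y)$ with $\sigma(S)=\sigma_{ap}(T)$, and a closed subspace $M\subset Y$ invariant under $S$ such that $T$ is similar to the restriction $S_{|M}$. For $p=1$ the operator $S$ can be taken to be, in addition, an extension of $T$. (2) Let $H$ be a Hilbert space. If $T\in B(H)$ satisfies, for some $C>0$ and $s\ge0$, $$\frac{1}{Cn^{s}}\|h\|\le\|T^nh\|\le Cn^{s}\|h\|\qquad(h\in H,\ n\ge 1),$$ then there exist a Hilbert space $K$ and an $\mathcal E(\mathbb T)$-scalar operator $S\in B(K)$ which is an extension of $T$ and satisfies $\sigma(S)=\sigma_{ap}(T)$. -/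

import Mathlib

open Filter Topology MeasureTheory
open scoped ENNReal Manifold ContDiff

universe u

noncomputable section

/-! ### The Fréchet algebra of smooth functions on the unit circle -/

/-- The complex-valued `C^∞` functions on the unit circle, as a subalgebra of all functions. -/
def smoothCircleSubalgebra : Subalgebra ℂ (Circle → ℂ) where
  carrier := {f | ContMDiff (𝓡 1) 𝓘(ℝ, ℂ) ∞ f}
  mul_mem' := fun hf hg => contDiff_mul.contMDiff.comp (ContMDiff.prodMk_space hf hg)
  add_mem' := fun hf hg => contDiff_add.contMDiff.comp (ContMDiff.prodMk_space hf hg)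
  algebraMap_mem' := fun _ => contMDiff_const

/-- The algebra `C^∞(𝕋)`. It is a type of its own, so that it does not carry the topology of
pointwise convergence. -/
def SmoothCircle : Type := smoothCircleSubalgebra

instance : CommRing SmoothCircle := inferInstanceAs (CommRing smoothCircleSubalgebra)

instance : Algebra ℂ SmoothCircle := inferInstanceAs (Algebra ℂ smoothCircleSubalgebra)

instance : CoeFun SmoothCircle (fun _ => Circle → ℂ) := ⟨fun f => f.1⟩

/-- The `k`-th derivative of `f` with respect to the angle, `t ↦ (d/dt)^k f(e^{it})`. -/
def SmoothCircle.angularDeriv (f : SmoothCircle) (k : ℕ) : ℝ → ℂ :=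
  iteratedDeriv k (fun t : ℝ => f (Circle.exp t))

/-- The Fréchet topology of `C^∞(𝕋)`: uniform convergence of the derivatives of all orders. -/
instance : TopologicalSpace SmoothCircle :=
  TopologicalSpace.induced
    (fun (f : SmoothCircle) (k : ℕ) => UniformFun.ofFun (f.angularDeriv k)) inferInstance

/-- The coordinate function `z` of `C^∞(𝕋)`. -/
def SmoothCircle.coord : SmoothCircle :=
  ⟨fun z => (z : ℂ), by
    have : Fact (Module.finrank ℝ ℂ = 1 + 1) := ⟨Complex.finrank_real_complex⟩
    exact contMDiff_coe_sphere (n := 1) (E := ℂ)⟩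

/-! ### Operators -/

/-- `T` is `ℰ(𝕋)`-scalar: it has a continuous functional calculus on `C^∞(𝕋)`, that is, there is
a continuous unital algebra homomorphism `Φ : C^∞(𝕋) → B(X)` with `Φ(z) = T`. -/
def IsETScalar {X : Type*} [NormedAddCommGroup X] [NormedSpace ℂ X] (T : X →L[ℂ] X) : Prop :=
  ∃ Φ : SmoothCircle →ₐ[ℂ] (X →L[ℂ] X), Continuous Φ ∧ Φ SmoothCircle.coord = T

/-- The restriction of `S` to an invariant subspace `M`, as an operator on `M`. -/
def restrictInvariant {Y : Type*} [NormedAddCommGroup Y] [NormedSpace ℂ Y] (S : Y →L[ℂ] Y)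
    (M : Submodule ℂ Y) (hM : ∀ y ∈ M, S y ∈ M) : M →L[ℂ] M :=
  (S.comp M.subtypeL).codRestrict M (fun y => hM y y.2)

/-- Operators `T` on `X` and `R` on `Z` are similar: `V T = R V` for a Banach space isomorphism
`V : X → Z`. -/
def IsSimilarTo {X Z : Type*} [NormedAddCommGroup X] [NormedSpace ℂ X]
    [NormedAddCommGroup Z] [NormedSpace ℂ Z] (T : X →L[ℂ] X) (R : Z →L[ℂ] Z) : Prop :=
  ∃ V : X ≃L[ℂ] Z, ∀ x, V (T x) = R (V x)

/-- `T` is similar to the restriction of `S` to a closed invariant subspace. -/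
def IsSimilarToRestriction {X Y : Type*} [NormedAddCommGroup X] [NormedSpace ℂ X]
    [NormedAddCommGroup Y] [NormedSpace ℂ Y] (T : X →L[ℂ] X) (S : Y →L[ℂ] Y) : Prop :=
  ∃ (M : Submodule ℂ Y) (hM : ∀ y ∈ M, S y ∈ M),
    IsClosed (M : Set Y) ∧ IsSimilarTo T (restrictInvariant S M hM)

/-- `S` on `Y` is an extension of `T` on `X`: there is a linear isometry `π : X → Y` with
`S π = π T`. -/
def IsExtensionOf {X Y : Type*} [NormedAddCommGroup X] [NormedSpace ℂ X]
    [NormedAddCommGroup Y] [NormedSpace ℂ Y] (S : Y →L[ℂ] Y) (T : X →L[ℂ] X) : Prop :=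
  ∃ π : X →ₗᵢ[ℂ] Y, ∀ x, S (π x) = π (T x)

/-- `T` is `ℰ(𝕋)`-subscalar: it is similar to the restriction of an `ℰ(𝕋)`-scalar operator on
some Banach space to a closed invariant subspace. -/
def IsETSubscalar {X : Type u} [NormedAddCommGroup X] [NormedSpace ℂ X] (T : X →L[ℂ] X) : Prop :=
  ∃ (Y : Type u) (_ : NormedAddCommGroup Y) (_ : NormedSpace ℂ Y) (_ : CompleteSpace Y)
    (S : Y →L[ℂ] Y), IsETScalar S ∧ IsSimilarToRestriction T S

/-- The approximate point spectrum of `T`. -/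
def approxPointSpectrum {X : Type*} [NormedAddCommGroup X] [NormedSpace ℂ X]
    (T : X →L[ℂ] X) : Set ℂ :=
  {z | ∀ ε : ℝ, 0 < ε → ∃ x : X, ‖x‖ = 1 ∧ ‖T x - z • x‖ < ε}

/-- The two-sided polynomial growth condition. -/
def PolynomialGrowth {X : Type*} [NormedAddCommGroup X] [NormedSpace ℂ X]
    (T : X →L[ℂ] X) : Prop :=
  ∃ C s : ℝ, 0 < C ∧ 0 ≤ s ∧ ∀ n : ℕ, 1 ≤ n → ∀ x : X,
    1 / (C * (n : ℝ) ^ s) * ‖x‖ ≤ ‖(T ^ n) x‖ ∧ ‖(T ^ n) x‖ ≤ C * (n : ℝ) ^ s * ‖x‖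

/-! ### Ultraproducts of Banach spaces and `SQ_p(X)`-spaces -/

/-- The bounded families whose norms tend to `0` along the ultrafilter. -/
def ultraNull {I : Type*} (E : I → Type*) [∀ i, NormedAddCommGroup (E i)]
    [∀ i, NormedSpace ℂ (E i)] (U : Ultrafilter I) : Submodule ℂ (lp E ⊤) where
  carrier := {x | Tendsto (fun i => ‖x i‖) (U : Filter I) (𝓝 0)}
  zero_mem' := by simp
  add_mem' := by
    intro x y hx hy
    refine squeeze_zero (fun i => norm_nonneg _) (fun i => ?_) (by simpa using hx.add hy)
    simpa using norm_add_le (x i) (y i)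
  smul_mem' := by
    intro c x hx
    have h := hx.const_mul ‖c‖
    simpa [norm_smul] using h

/-- The Banach space ultraproduct: bounded families modulo those whose norms tend to `0` along
the ultrafilter, with the quotient norm. -/
abbrev BanachUltraproduct {I : Type*} (E : I → Type*) [∀ i, NormedAddCommGroup (E i)]
    [∀ i, NormedSpace ℂ (E i)] (U : Ultrafilter I) : Type _ :=
  lp E ⊤ ⧸ ultraNull E U

/-- `Y` is an `SQ_p(X)`-space: it is isometric to a quotient `G ⧸ N` of a closed subspace `G` of an
ultraproduct of spaces `L_p(Ω_i, μ_i, X)`. -/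
def IsSQpSpace (p : ℝ≥0∞) [Fact (1 ≤ p)] (X Y : Type u)
    [NormedAddCommGroup X] [NormedSpace ℂ X] [NormedAddCommGroup Y] [NormedSpace ℂ Y] : Prop :=
  ∃ (I : Type u) (U : Ultrafilter I) (Ω : I → Type u) (_ : ∀ i, MeasurableSpace (Ω i))
    (μ : ∀ i, Measure (Ω i))
    (G : Submodule ℂ (BanachUltraproduct (fun i => Lp X p (μ i)) U)) (N : Submodule ℂ G),
    IsClosed (G : Set (BanachUltraproduct (fun i => Lp X p (μ i)) U)) ∧
      IsClosed (N : Set G) ∧ Nonempty (Y ≃ₗᵢ[ℂ] (G ⧸ N))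

end

/-!
The proof rests on one estimate. Let `T` satisfy the two-sided growth condition and suppose that
`x = g₀ + T⁻¹ g₁ + T⁻² g₂ + ⋯` in the direct limit of `X → X → ⋯`, on which `T` becomes invertible.
Then `‖x‖ ≤ ‖g₀‖ + ∑ (n + 1) ^ L ‖gₙ‖` for some `L` depending only on the growth of `T`. The
remainders `fₙ` of the series belong to `X` and satisfy `T fₙ = fₙ₊₁ + gₙ₊₁`, so the lower bound for
`T ^ k` controls `fₙ` by `fₙ₊ₖ` at the cost of a factor `k ^ s`. Passing from `2` to `N` step by step,
or by doubling, loses more than a power of `N`; passing from `q` to `q ^ 2` loses the factors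
`C q ^ (2 s)` at `q = 2 ^ 2 ^ i`, whose product is again a power of `N`
(`HasGrowth.weighted_norm_le_sq`, `HasGrowth.exists_norm_le_of_recursion`).

Consequently `X` embeds in the quotient `Y` of a weighted `ℓ_p(ℕ, X)`, where `x` in position `n`
stands for `T⁻ⁿ x`, by the closure of the relations "`x` in position `n` equals `T x` in position
`n + 1`". On `Y` the operator `S` induced by `T` acting in every coordinate is inverse to the one
induced by the right shift, and both have powers of polynomial growth
(`isETScalar_quotientOperator`). An operator `Q` on `X` commuting with `T` also induces an operator
on `Y`. This gives `σ(S) = σ_ap(T)`: the spectrum of `S` lies on the unit circle, and if a point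
`z` of the circle is not in `σ_ap(T)`, then the resolvent of `T` is bounded near `z` outside the disc,
so that `T - z` is invertible and its inverse is such a `Q` (`HasGrowth.exists_scalar_extension`).

An invertible operator with powers of polynomial growth in both directions is scalar by the calculus
`f ↦ ∑ f̂(n) S ^ n`, as the Fourier coefficients of a smooth function decay rapidly
(`isETScalar_of_norm_pow_le`). Conversely a continuous homomorphism on `C^∞(𝕋)` has finite order,
which bounds the images of `z ^ n` by a power of `|n|` (`IsETScalar.exists_norm_pow_le`).

In the Hilbert space case `p = 2` yields a Hilbert space `Y` in which `H` is embedded with an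
equivalent norm; replacing the norm of `Y` by that of `H ⊕ Hᗮ` makes the embedding isometric
(`exists_hilbert_renorming`).
-/

/-! ### Fourier coefficients of smooth functions on the circle -/

namespace SmoothCircle

instance factTwoPi : Fact (0 < 2 * Real.pi) := ⟨Real.two_pi_pos⟩

theorem contDiff_comp_exp (f : SmoothCircle) : ContDiff ℝ ∞ (fun t : ℝ => f (Circle.exp t)) := by
  have h : ContMDiff (𝓡 1) 𝓘(ℝ, ℂ) ∞ f.1 := f.2
  exact (h.comp contMDiff_circleExp).contDiff

theorem continuous_coe (f : SmoothCircle) : Continuous f.1 := by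
  have h : ContMDiff (𝓡 1) 𝓘(ℝ, ℂ) ∞ f.1 := f.2
  exact h.continuous

theorem contDiff_angularDeriv (f : SmoothCircle) (k : ℕ) : ContDiff ℝ ∞ (f.angularDeriv k) := by
  have := f.contDiff_comp_exp
  unfold angularDeriv
  rw [iteratedDeriv_eq_iterate]
  exact ContDiff.iterate_deriv k this

theorem angularDeriv_zero_apply (f : SmoothCircle) (t : ℝ) :
    f.angularDeriv 0 t = f (Circle.exp t) := by
  simp [angularDeriv]

theorem angularDeriv_succ (f : SmoothCircle) (k : ℕ) :
    f.angularDeriv (k + 1) = deriv (f.angularDeriv k) := iteratedDeriv_succ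

theorem periodic_angularDeriv (f : SmoothCircle) (k : ℕ) :
    Function.Periodic (f.angularDeriv k) (2 * Real.pi) := by
  induction k with
  | zero =>
    intro t
    simp [angularDeriv_zero_apply, Circle.exp_add]
  | succ k ih =>
    intro t
    rw [angularDeriv_succ, ← deriv_comp_add_const]
    congr 1
    ext s
    exact ih s

theorem angularDeriv_sub (f g : SmoothCircle) (k : ℕ) (t : ℝ) :
    (f - g).angularDeriv k t = f.angularDeriv k t - g.angularDeriv k t :=
  iteratedDeriv_sub ((f.contDiff_comp_exp.of_le (by exact_mod_cast le_top)).contDiffAt)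
    ((g.contDiff_comp_exp.of_le (by exact_mod_cast le_top)).contDiffAt)

theorem exists_bound_angularDeriv (f : SmoothCircle) (k : ℕ) :
    ∃ δ : ℝ, 0 ≤ δ ∧ ∀ t, ‖f.angularDeriv k t‖ ≤ δ := by
  obtain ⟨C, hC⟩ := (isCompact_Icc (a := (0 : ℝ)) (b := 2 * Real.pi)).exists_bound_of_continuousOn
    (f.contDiff_angularDeriv k).continuous.continuousOn
  refine ⟨C, (norm_nonneg _).trans (hC 0 ⟨le_rfl, Real.two_pi_pos.le⟩), fun t => ?_⟩
  obtain ⟨s, hs, hst⟩ := (f.periodic_angularDeriv k).exists_mem_Ico₀ Real.two_pi_pos t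
  rw [hst]
  exact hC s ⟨hs.1, hs.2.le⟩

/-- A smooth function on the circle, as a continuous function on `ℝ / 2πℤ`. -/
noncomputable def toAddCircle (f : SmoothCircle) : C(AddCircle (2 * Real.pi), ℂ) :=
  (⟨f.1, f.continuous_coe⟩ : C(Circle, ℂ)).comp ⟨AddCircle.homeomorphCircle', by fun_prop⟩

theorem toAddCircle_coe (f : SmoothCircle) (t : ℝ) :
    f.toAddCircle (t : AddCircle (2 * Real.pi)) = f (Circle.exp t) := rfl

/-- The `n`-th Fourier coefficient of a smooth function on the circle. -/
noncomputable def coeff (f : SmoothCircle) (n : ℤ) : ℂ := fourierCoeff f.toAddCircle n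

/-- The `n`-th Fourier coefficient of the `k`-th derivative is `(i n)^k` times that of the
function. -/
theorem coeff_eq_integral_angularDeriv (f : SmoothCircle) (n : ℤ) (k : ℕ) :
    (Complex.I * n) ^ k * f.coeff n = ((1 / (2 * Real.pi) : ℝ) : ℂ) *
      ∫ t in (0 : ℝ)..2 * Real.pi, Complex.exp (-(Complex.I * n * t)) * f.angularDeriv k t := by
  induction k with
  | zero =>
    rw [coeff, fourierCoeff_eq_intervalIntegral _ _ 0, pow_zero, one_mul, zero_add,
      Complex.real_smul]
    congr 2
    ext t
    rw [angularDeriv_zero_apply, ← toAddCircle_coe, smul_eq_mul, fourier_coe_apply]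
    congr 2
    have : (Real.pi : ℂ) ≠ 0 := by exact_mod_cast Real.pi_ne_zero
    push_cast
    field_simp
  | succ k ih =>
    rw [pow_succ', mul_assoc, ih, mul_left_comm]
    congr 1
    have hu : ∀ t ∈ Set.uIcc (0 : ℝ) (2 * Real.pi),
        HasDerivAt (fun t : ℝ => Complex.exp (-(Complex.I * n * t)))
          (Complex.exp (-(Complex.I * n * t)) * (-(Complex.I * n))) t := by
      intro t _
      have h1 : HasDerivAt (fun t : ℝ => -(Complex.I * n * (t : ℂ))) (-(Complex.I * n)) t := by
        simpa using ((Complex.ofRealCLM.hasDerivAt (x := t)).const_mul (Complex.I * n)).fun_neg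
      exact h1.cexp
    have hv : ∀ t ∈ Set.uIcc (0 : ℝ) (2 * Real.pi),
        HasDerivAt (f.angularDeriv k) (f.angularDeriv (k + 1) t) t := by
      intro t _
      rw [angularDeriv_succ]
      exact ((f.contDiff_angularDeriv k).differentiable (by simp) t).hasDerivAt
    rw [intervalIntegral.integral_mul_deriv_eq_deriv_mul hu hv
      (by apply Continuous.intervalIntegrable; fun_prop)
      ((f.contDiff_angularDeriv (k + 1)).continuous.intervalIntegrable _ _)]
    have h0 : f.angularDeriv k (2 * Real.pi) = f.angularDeriv k 0 := by
      simpa using f.periodic_angularDeriv k 0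
    have h1 : Complex.exp (-(Complex.I * n * ((2 * Real.pi : ℝ) : ℂ))) = 1 := by
      rw [Complex.exp_eq_one_iff]
      exact ⟨-n, by push_cast; ring⟩
    rw [h0, h1, ← intervalIntegral.integral_const_mul]
    simp only [Complex.ofReal_zero, mul_zero, neg_zero, Complex.exp_zero, sub_self, zero_sub]
    rw [← intervalIntegral.integral_neg]
    congr 1
    ext t
    ring

theorem abs_pow_mul_norm_coeff_le (f : SmoothCircle) (n : ℤ) (k : ℕ) {δ : ℝ}
    (h : ∀ t, ‖f.angularDeriv k t‖ ≤ δ) : |(n : ℝ)| ^ k * ‖f.coeff n‖ ≤ δ := by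
  have h1 := congrArg norm (f.coeff_eq_integral_angularDeriv n k)
  rw [norm_mul, norm_pow, norm_mul, Complex.norm_I, one_mul, Complex.norm_intCast] at h1
  rw [h1, norm_mul, Complex.norm_real, Real.norm_of_nonneg (by positivity)]
  have h2 : ‖∫ t in (0 : ℝ)..2 * Real.pi,
      Complex.exp (-(Complex.I * n * t)) * f.angularDeriv k t‖ ≤ δ * |2 * Real.pi - 0| := by
    apply intervalIntegral.norm_integral_le_of_norm_le_const
    intro t _
    have : -(Complex.I * n * t) = ((-(n * t) : ℝ) : ℂ) * Complex.I := by push_cast; ring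
    rw [norm_mul, this, Complex.norm_exp_ofReal_mul_I, one_mul]
    exact h t
  rw [sub_zero, abs_of_pos Real.two_pi_pos] at h2
  calc 1 / (2 * Real.pi) * _ ≤ 1 / (2 * Real.pi) * (δ * (2 * Real.pi)) := by gcongr
    _ = δ := by field_simp

theorem weighted_norm_coeff_le (f : SmoothCircle) (n : ℤ) (k : ℕ) {δ₀ δ : ℝ}
    (h₀ : ∀ t, ‖f.angularDeriv 0 t‖ ≤ δ₀) (h : ∀ t, ‖f.angularDeriv k t‖ ≤ δ) :
    (|(n : ℝ)| + 1) ^ k * ‖f.coeff n‖ ≤ 2 ^ k * (δ₀ + δ) := by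
  have a := f.abs_pow_mul_norm_coeff_le n 0 h₀
  have b := f.abs_pow_mul_norm_coeff_le n k h
  rw [pow_zero, one_mul] at a
  have c : (|(n : ℝ)| + 1) ^ k ≤ 2 ^ k * (1 + |(n : ℝ)| ^ k) := by
    rcases le_total |(n : ℝ)| 1 with hn | hn
    · calc (|(n : ℝ)| + 1) ^ k ≤ 2 ^ k := by gcongr; linarith
        _ ≤ _ := le_mul_of_one_le_right (by positivity) (by simp)
    · calc (|(n : ℝ)| + 1) ^ k ≤ (2 * |(n : ℝ)|) ^ k := by gcongr; linarith
        _ = 2 ^ k * |(n : ℝ)| ^ k := mul_pow _ _ _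
        _ ≤ _ := by gcongr; simp
  calc _ ≤ 2 ^ k * (1 + |(n : ℝ)| ^ k) * ‖f.coeff n‖ := by gcongr
    _ = 2 ^ k * (‖f.coeff n‖ + |(n : ℝ)| ^ k * ‖f.coeff n‖) := by ring
    _ ≤ _ := by gcongr

theorem summable_inv_sq_abs_add_one : Summable fun n : ℤ => ((|(n : ℝ)| + 1) ^ 2)⁻¹ := by
  have h : Summable fun n : ℕ => (((n : ℝ) + 1) ^ 2)⁻¹ := by
    have := (summable_nat_add_iff 1).2 (Real.summable_nat_pow_inv (p := 2).2 (by norm_num))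
    simpa using this
  refine Summable.of_nat_of_neg ?_ ?_ <;> simpa using h

theorem norm_coeff_mul_le (f : SmoothCircle) (n : ℤ) (r : ℕ) {δ₀ δ : ℝ}
    (h₀ : ∀ t, ‖f.angularDeriv 0 t‖ ≤ δ₀) (h : ∀ t, ‖f.angularDeriv (r + 2) t‖ ≤ δ) :
    ‖f.coeff n‖ * (|(n : ℝ)| + 1) ^ r ≤
      2 ^ (r + 2) * (δ₀ + δ) * ((|(n : ℝ)| + 1) ^ 2)⁻¹ := by
  have h1 := f.weighted_norm_coeff_le n (r + 2) h₀ h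
  rw [← div_eq_mul_inv, le_div_iff₀ (by positivity)]
  calc _ = (|(n : ℝ)| + 1) ^ (r + 2) * ‖f.coeff n‖ := by ring
    _ ≤ _ := h1

theorem summable_norm_coeff_mul (f : SmoothCircle) (r : ℕ) :
    Summable fun n : ℤ => ‖f.coeff n‖ * (|(n : ℝ)| + 1) ^ r := by
  obtain ⟨δ₀, -, h₀⟩ := f.exists_bound_angularDeriv 0
  obtain ⟨δ, -, h⟩ := f.exists_bound_angularDeriv (r + 2)
  exact Summable.of_nonneg_of_le (fun n => by positivity) (fun n => f.norm_coeff_mul_le n r h₀ h)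
    (summable_inv_sq_abs_add_one.mul_left _)

theorem summable_norm_coeff (f : SmoothCircle) : Summable fun n : ℤ => ‖f.coeff n‖ := by
  simpa using f.summable_norm_coeff_mul 0

theorem coeff_add (f g : SmoothCircle) (n : ℤ) : (f + g).coeff n = f.coeff n + g.coeff n := by
  have h := fourierCoeff.add (T := 2 * Real.pi) (f := f.toAddCircle) (g := g.toAddCircle)
    (f.toAddCircle.continuous.integrable_of_hasCompactSupport (HasCompactSupport.of_compactSpace _))
    (g.toAddCircle.continuous.integrable_of_hasCompactSupport (HasCompactSupport.of_compactSpace _))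
  exact congrFun h n

theorem coeff_smul (c : ℂ) (f : SmoothCircle) (n : ℤ) : (c • f).coeff n = c * f.coeff n :=
  fourierCoeff.const_smul (T := 2 * Real.pi) f.toAddCircle c n

theorem coeff_one (n : ℤ) : (1 : SmoothCircle).coeff n = (Pi.single 0 1 : ℤ → ℂ) n := by
  have h : ((1 : SmoothCircle).toAddCircle : AddCircle (2 * Real.pi) → ℂ) = fourier 0 := by
    ext x
    simp only [fourier_zero]
    rfl
  rw [coeff, h, fourierCoeff_fourier]

theorem coeff_coord (n : ℤ) : coord.coeff n = (Pi.single 1 1 : ℤ → ℂ) n := by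
  have h : (coord.toAddCircle : AddCircle (2 * Real.pi) → ℂ) = fourier 1 := by
    ext x
    induction x using QuotientAddGroup.induction_on with
    | H t =>
      rw [fourier_one]
      change ((Circle.exp t : Circle) : ℂ) = _
      congr 1
      rw [AddCircle.toCircle_apply_mk, div_self Real.two_pi_pos.ne', one_mul]
  rw [coeff, h, fourierCoeff_fourier]

theorem tsum_coeff_mul_fourier (f g : SmoothCircle) (n : ℤ) (t : AddCircle (2 * Real.pi)) :
    ∑' k, f.coeff k * (fourier (-(n - k)) t * g.toAddCircle t) =
      fourier (-n) t * (f * g).toAddCircle t := by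
  have hp := has_pointwise_sum_fourier_series_of_summable
    (f := f.toAddCircle) f.summable_norm_coeff.of_norm t
  have hq := (hp.mul_right (fourier (-n) t * g.toAddCircle t)).tsum_eq
  have hfg : (f * g).toAddCircle t = f.toAddCircle t * g.toAddCircle t := rfl
  rw [hfg, mul_left_comm, ← hq]
  refine tsum_congr fun k => ?_
  have h : -(n - k) = k + -n := by ring
  rw [h, fourier_add, smul_eq_mul, coeff]
  ring

/-- The Fourier coefficients of a product are the convolution of the Fourier coefficients. -/
theorem hasSum_coeff_mul (f g : SmoothCircle) (n : ℤ) :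
    HasSum (fun k => f.coeff k * g.coeff (n - k)) ((f * g).coeff n) := by
  have hint : ∀ k, Integrable (fun t => f.coeff k * (fourier (-(n - k)) t * g.toAddCircle t))
      (AddCircle.haarAddCircle (T := 2 * Real.pi)) := fun k =>
    (f.coeff k • (fourier (-(n - k)) * g.toAddCircle)).continuous.integrable_of_hasCompactSupport
      (HasCompactSupport.of_compactSpace _)
  have hnorm : ∀ k, ∫ t, ‖f.coeff k * (fourier (-(n - k)) t * g.toAddCircle t)‖
      ∂(AddCircle.haarAddCircle (T := 2 * Real.pi)) =
      ‖f.coeff k‖ * ∫ t, ‖g.toAddCircle t‖ ∂AddCircle.haarAddCircle := by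
    intro k
    rw [← integral_const_mul]
    refine integral_congr_ae (ae_of_all _ fun t => ?_)
    simp only [norm_mul, fourier_apply, Circle.norm_coe, one_mul]
  have hF := hasSum_integral_of_summable_integral_norm hint (by
    simp_rw [hnorm]
    exact f.summable_norm_coeff.mul_right _)
  simp_rw [tsum_coeff_mul_fourier, integral_const_mul] at hF
  exact hF

end SmoothCircle

/-! ### The functional calculus of an operator with polynomially bounded powers -/

namespace SmoothCircle

section Calculus

variable {A : Type*} [NormedRing A] [NormedAlgebra ℂ A]

theorem summable_norm_coeff_smul_zpow (u : Aˣ) {M : ℝ} {r : ℕ}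
    (hu : ∀ n : ℤ, ‖((u ^ n : Aˣ) : A)‖ ≤ M * (|(n : ℝ)| + 1) ^ r) (f : SmoothCircle) :
    Summable fun n : ℤ => ‖f.coeff n • ((u ^ n : Aˣ) : A)‖ := by
  refine Summable.of_nonneg_of_le (fun n => norm_nonneg _) (fun n => ?_)
    ((f.summable_norm_coeff_mul r).mul_left M)
  rw [norm_smul]
  calc _ ≤ ‖f.coeff n‖ * (M * (|(n : ℝ)| + 1) ^ r) := by gcongr; exact hu n
    _ = _ := by ring

variable [CompleteSpace A]

/-- The functional calculus `f ↦ ∑ f̂(n) u ^ n` for an invertible element `u` whose powers grow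
polynomially in both directions. -/
noncomputable def calculus (u : Aˣ) {M : ℝ} {r : ℕ}
    (hu : ∀ n : ℤ, ‖((u ^ n : Aˣ) : A)‖ ≤ M * (|(n : ℝ)| + 1) ^ r) : SmoothCircle →ₐ[ℂ] A :=
  AlgHom.ofLinearMap
    { toFun := fun f => ∑' n : ℤ, f.coeff n • ((u ^ n : Aˣ) : A)
      map_add' := fun f g => by
        rw [← ((summable_norm_coeff_smul_zpow u hu f).of_norm).tsum_add
          ((summable_norm_coeff_smul_zpow u hu g).of_norm)]
        simp_rw [coeff_add, add_smul]
      map_smul' := fun c f => by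
        rw [RingHom.id_apply, ← ((summable_norm_coeff_smul_zpow u hu f).of_norm).tsum_const_smul]
        simp_rw [coeff_smul, mul_smul] }
    (by
      change ∑' n : ℤ, (1 : SmoothCircle).coeff n • ((u ^ n : Aˣ) : A) = 1
      rw [tsum_eq_single 0 (fun n hn => by rw [coeff_one, Pi.single_eq_of_ne hn, zero_smul])]
      simp [coeff_one])
    (fun f g => by
      change ∑' n : ℤ, (f * g).coeff n • ((u ^ n : Aˣ) : A) =
        (∑' n : ℤ, f.coeff n • ((u ^ n : Aˣ) : A)) * ∑' n : ℤ, g.coeff n • ((u ^ n : Aˣ) : A)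
      have hf := summable_norm_coeff_smul_zpow u hu f
      have hg := summable_norm_coeff_smul_zpow u hu g
      have hs := summable_mul_of_summable_norm hf hg
      rw [tsum_mul_tsum_of_summable_norm hf hg]
      -- reindex the double series by `(m, n) ↦ (m, m + n)`
      let e : ℤ × ℤ ≃ ℤ × ℤ :=
        { toFun := fun x => (x.2, x.1 - x.2)
          invFun := fun x => (x.1 + x.2, x.1)
          left_inv := fun x => by simp
          right_inv := fun x => by simp }
      rw [← e.tsum_eq (fun x : ℤ × ℤ => (f.coeff x.1 • ((u ^ x.1 : Aˣ) : A)) *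
        (g.coeff x.2 • ((u ^ x.2 : Aˣ) : A)))]
      refine Eq.trans ?_ ((e.summable_iff).2 hs).tsum_prod.symm
      refine tsum_congr fun n => ?_
      rw [← ((hasSum_coeff_mul f g n).smul_const ((u ^ n : Aˣ) : A)).tsum_eq]
      refine tsum_congr fun k => ?_
      change _ = (f.coeff k • ((u ^ k : Aˣ) : A)) * (g.coeff (n - k) • ((u ^ (n - k) : Aˣ) : A))
      rw [smul_mul_smul_comm, ← Units.val_mul, ← zpow_add, add_sub_cancel])

theorem calculus_apply (u : Aˣ) {M : ℝ} {r : ℕ}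
    (hu : ∀ n : ℤ, ‖((u ^ n : Aˣ) : A)‖ ≤ M * (|(n : ℝ)| + 1) ^ r) (f : SmoothCircle) :
    calculus u hu f = ∑' n : ℤ, f.coeff n • ((u ^ n : Aˣ) : A) := rfl

theorem calculus_coord (u : Aˣ) {M : ℝ} {r : ℕ}
    (hu : ∀ n : ℤ, ‖((u ^ n : Aˣ) : A)‖ ≤ M * (|(n : ℝ)| + 1) ^ r) :
    calculus u hu coord = u := by
  rw [calculus_apply,
    tsum_eq_single 1 (fun n hn => by rw [coeff_coord, Pi.single_eq_of_ne hn, zero_smul])]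
  simp [coeff_coord]

theorem norm_calculus_le (u : Aˣ) {M : ℝ} {r : ℕ} (hM : 0 ≤ M)
    (hu : ∀ n : ℤ, ‖((u ^ n : Aˣ) : A)‖ ≤ M * (|(n : ℝ)| + 1) ^ r) (f : SmoothCircle)
    {δ : ℝ} (h₀ : ∀ t, ‖f.angularDeriv 0 t‖ ≤ δ) (h : ∀ t, ‖f.angularDeriv (r + 2) t‖ ≤ δ) :
    ‖calculus u hu f‖ ≤
      δ * (M * 2 ^ (r + 3) * ∑' n : ℤ, ((|(n : ℝ)| + 1) ^ 2)⁻¹) := by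
  rw [calculus_apply]
  refine (tsum_of_norm_bounded ((summable_inv_sq_abs_add_one.mul_left
    (M * (2 ^ (r + 2) * (δ + δ)))).hasSum) (fun n => ?_)).trans_eq ?_
  · rw [norm_smul]
    calc _ ≤ ‖f.coeff n‖ * (M * (|(n : ℝ)| + 1) ^ r) := by gcongr; exact hu n
      _ = M * (‖f.coeff n‖ * (|(n : ℝ)| + 1) ^ r) := by ring
      _ ≤ M * (2 ^ (r + 2) * (δ + δ) * ((|(n : ℝ)| + 1) ^ 2)⁻¹) := by
        exact mul_le_mul_of_nonneg_left (f.norm_coeff_mul_le n r h₀ h) hM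
      _ = _ := by ring
  · rw [tsum_mul_left]; ring

theorem eventually_norm_angularDeriv_sub_le (f : SmoothCircle) (k : ℕ) {δ : ℝ} (hδ : 0 < δ) :
    ∀ᶠ g in 𝓝 f, ∀ t, ‖(g - f).angularDeriv k t‖ ≤ δ := by
  have h : Continuous fun (g : SmoothCircle) (k : ℕ) => UniformFun.ofFun (g.angularDeriv k) :=
    continuous_induced_dom
  have hk : Tendsto (fun g : SmoothCircle => UniformFun.ofFun (g.angularDeriv k)) (𝓝 f)
      (𝓝 (UniformFun.ofFun (f.angularDeriv k))) :=
    ((continuous_apply k).comp h).tendsto f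
  rw [UniformFun.tendsto_iff_tendstoUniformly, Metric.tendstoUniformly_iff] at hk
  filter_upwards [hk δ hδ] with g hg t
  rw [angularDeriv_sub, ← dist_eq_norm, dist_comm]
  exact (hg t).le

theorem continuous_calculus (u : Aˣ) {M : ℝ} {r : ℕ} (hM : 0 ≤ M)
    (hu : ∀ n : ℤ, ‖((u ^ n : Aˣ) : A)‖ ≤ M * (|(n : ℝ)| + 1) ^ r) :
    Continuous (calculus u hu) := by
  rw [continuous_iff_continuousAt]
  intro f
  rw [ContinuousAt, Metric.tendsto_nhds]
  intro ε hε
  set D : ℝ := M * 2 ^ (r + 3) * ∑' n : ℤ, ((|(n : ℝ)| + 1) ^ 2)⁻¹ with hD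
  have hD0 : 0 ≤ D := mul_nonneg (by positivity) (tsum_nonneg fun n => by positivity)
  have hδ : 0 < ε / (D + 1) := by positivity
  filter_upwards [f.eventually_norm_angularDeriv_sub_le 0 hδ,
    f.eventually_norm_angularDeriv_sub_le (r + 2) hδ] with g h₀ h
  rw [dist_eq_norm, ← map_sub]
  calc _ ≤ ε / (D + 1) * D := norm_calculus_le u hM hu _ h₀ h
    _ < ε / (D + 1) * (D + 1) := by gcongr; linarith
    _ = ε := by field_simp

end Calculus

/-! ### Powers of scalar operators -/

/-- The inverse of the coordinate function. -/
noncomputable def coordInv : SmoothCircle :=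
  ⟨fun z => ((z⁻¹ : Circle) : ℂ), by
    have h : ContMDiff (𝓡 1) 𝓘(ℝ, ℂ) ∞ coord.1 := coord.2
    exact h.comp (contMDiff_inv (𝓡 1) ∞)⟩

theorem coord_mul_coordInv : coord * coordInv = 1 := by
  apply Subtype.ext
  funext z
  change (z : ℂ) * ((z⁻¹ : Circle) : ℂ) = 1
  rw [← Circle.coe_mul, mul_inv_cancel, Circle.coe_one]

theorem norm_angularDeriv_smul_exp (f : SmoothCircle) (c : ℂ) (n : ℤ)
    (hf : ∀ t : ℝ, f (Circle.exp t) = c * Complex.exp (Complex.I * n * t)) (k : ℕ) (t : ℝ) :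
    ‖f.angularDeriv k t‖ = ‖c‖ * |(n : ℝ)| ^ k := by
  have h : ∀ t : ℝ, f.angularDeriv k t =
      c * (Complex.I * n) ^ k * Complex.exp (Complex.I * n * t) := by
    induction k with
    | zero => intro t; simp [angularDeriv_zero_apply, hf]
    | succ k ih =>
      intro t
      rw [angularDeriv_succ, funext ih]
      have h1 : HasDerivAt (fun t : ℝ => (Complex.I * n * (t : ℂ))) (Complex.I * n) t := by
        simpa using ((Complex.ofRealCLM.hasDerivAt (x := t)).const_mul (Complex.I * n))
      rw [(h1.cexp.const_mul _).deriv]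
      ring
  have h2 : Complex.I * n * t = ((n * t : ℝ) : ℂ) * Complex.I := by push_cast; ring
  rw [h, norm_mul, h2, Complex.norm_exp_ofReal_mul_I, norm_mul, norm_pow, norm_mul, Complex.norm_I,
    Complex.norm_intCast]
  ring

/-- A neighbourhood of `0` in `C^∞(𝕋)` contains all functions with finitely many small
derivatives. -/
theorem exists_ball_subset_of_mem_nhds_zero {s : Set SmoothCircle} (hs : s ∈ 𝓝 (0 : SmoothCircle)) :
    ∃ (K : ℕ) (ε : ℝ), 0 < ε ∧
      ∀ f : SmoothCircle, (∀ k ≤ K, ∀ t, ‖f.angularDeriv k t‖ ≤ ε) → f ∈ s := by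
  rw [nhds_induced, mem_comap] at hs
  obtain ⟨v, hv, hvs⟩ := hs
  rw [nhds_pi, Filter.mem_pi] at hv
  obtain ⟨I, hI, w, hw, hwv⟩ := hv
  have h0 : ∀ k t, (0 : SmoothCircle).angularDeriv k t = 0 := by
    intro k t
    have := (0 : SmoothCircle).angularDeriv_sub 0 k t
    rwa [sub_self, sub_self] at this
  have hε : ∀ k, ∃ ε : ℝ, 0 < ε ∧ ∀ f : SmoothCircle, (∀ t, ‖f.angularDeriv k t‖ ≤ ε) →
      UniformFun.ofFun (f.angularDeriv k) ∈ w k := by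
    intro k
    obtain ⟨V, hV, hVw⟩ := (UniformFun.hasBasis_nhds ℝ ℂ _).mem_iff.1 (hw k)
    obtain ⟨ε, hε, hεV⟩ := Metric.mem_uniformity_dist.1 hV
    refine ⟨ε / 2, by positivity, fun f hf => hVw ?_⟩
    intro t
    apply hεV
    change dist ((0 : SmoothCircle).angularDeriv k t) (f.angularDeriv k t) < ε
    rw [h0, dist_zero_left]
    linarith [hf t]
  choose ε hε0 hε using hε
  obtain ⟨K, hK⟩ := hI.bddAbove
  have hne : (Finset.range (K + 1)).Nonempty := ⟨0, by simp⟩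
  refine ⟨K, (Finset.range (K + 1)).inf' hne ε, (Finset.lt_inf'_iff hne).2 fun k _ => hε0 k,
    fun f hf => hvs (hwv ?_)⟩
  intro k hk
  have hkK : k ≤ K := hK hk
  exact hε k f fun t => (hf k hkK t).trans
    (Finset.inf'_le ε (Finset.mem_range.2 (Nat.lt_succ_of_le hkK)))

/-- A continuous homomorphism from `C^∞(𝕋)` to a Banach algebra is of finite order. -/
theorem exists_norm_le_of_continuous {A : Type*} [NormedRing A] [NormedAlgebra ℂ A]
    {Φ : SmoothCircle →ₐ[ℂ] A} (hΦ : Continuous Φ) :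
    ∃ (K : ℕ) (D : ℝ), 0 < D ∧ ∀ (f : SmoothCircle) (n : ℤ),
      (∀ t : ℝ, f (Circle.exp t) = Complex.exp (Complex.I * n * t)) →
        ‖Φ f‖ ≤ D * (|(n : ℝ)| + 1) ^ K := by
  have hmem : Φ ⁻¹' Metric.ball 0 1 ∈ 𝓝 (0 : SmoothCircle) := by
    apply hΦ.continuousAt
    rw [map_zero]
    exact Metric.ball_mem_nhds _ one_pos
  obtain ⟨K, ε, hε, h⟩ := exists_ball_subset_of_mem_nhds_zero hmem
  refine ⟨K, ε⁻¹, inv_pos.2 hε, fun f n hf => ?_⟩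
  set c : ℝ := ε / (|(n : ℝ)| + 1) ^ K with hc
  have hc0 : 0 < c := by positivity
  have hcf : ((c : ℂ) • f) ∈ Φ ⁻¹' Metric.ball 0 1 := by
    refine h _ fun k hk t => ?_
    rw [norm_angularDeriv_smul_exp ((c : ℂ) • f) c n
      (fun t => congrArg (fun z => (c : ℂ) * z) (hf t)), Complex.norm_real,
      Real.norm_of_nonneg hc0.le]
    calc c * |(n : ℝ)| ^ k ≤ c * (|(n : ℝ)| + 1) ^ K := by
          gcongr
          calc |(n : ℝ)| ^ k ≤ (|(n : ℝ)| + 1) ^ k := by gcongr; linarith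
            _ ≤ _ := pow_le_pow_right₀ (by linarith [abs_nonneg (n : ℝ)]) hk
      _ = ε := by rw [hc]; field_simp
  rw [Set.mem_preimage, map_smul, mem_ball_zero_iff, norm_smul, Complex.norm_real,
    Real.norm_of_nonneg hc0.le] at hcf
  have h1 : ‖Φ f‖ ≤ 1 / c := by
    rw [le_div_iff₀ hc0, mul_comm]
    exact hcf.le
  calc _ ≤ 1 / c := h1
    _ = _ := by rw [hc]; field_simp

theorem coord_pow_apply_exp (n : ℕ) (t : ℝ) :
    (coord ^ n) (Circle.exp t) = Complex.exp (Complex.I * (n : ℤ) * t) := by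
  change (((Circle.exp t : Circle) : ℂ)) ^ n = _
  rw [Circle.coe_exp, ← Complex.exp_nat_mul]
  congr 1
  push_cast
  ring

theorem coordInv_pow_apply_exp (n : ℕ) (t : ℝ) :
    (coordInv ^ n) (Circle.exp t) = Complex.exp (Complex.I * (-n : ℤ) * t) := by
  change ((((Circle.exp t)⁻¹ : Circle) : ℂ)) ^ n = _
  rw [← Circle.exp_neg, Circle.coe_exp, ← Complex.exp_nat_mul]
  congr 1
  push_cast
  ring

end SmoothCircle

section Scalar

variable {Y : Type*} [NormedAddCommGroup Y] [NormedSpace ℂ Y]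

/-- An invertible operator whose powers grow polynomially in both directions is scalar. -/
theorem isETScalar_of_norm_pow_le [CompleteSpace Y] {S R : Y →L[ℂ] Y} (hSR : S * R = 1)
    (hRS : R * S = 1) {M : ℝ} {r : ℕ} (hS : ∀ n : ℕ, ‖S ^ n‖ ≤ M * ((n : ℝ) + 1) ^ r)
    (hR : ∀ n : ℕ, ‖R ^ n‖ ≤ M * ((n : ℝ) + 1) ^ r) : IsETScalar S := by
  let u : (Y →L[ℂ] Y)ˣ := ⟨S, R, hSR, hRS⟩
  have hM : 0 ≤ M := by simpa using (norm_nonneg _).trans (hS 0)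
  have hu : ∀ n : ℤ, ‖((u ^ n : (Y →L[ℂ] Y)ˣ) : Y →L[ℂ] Y)‖ ≤ M * (|(n : ℝ)| + 1) ^ r := by
    intro n
    obtain ⟨m, rfl | rfl⟩ := n.eq_nat_or_neg
    · simpa using hS m
    · rw [zpow_neg, zpow_natCast, ← inv_pow, Units.val_pow_eq_pow_val]
      simpa [u] using hR m
  exact ⟨SmoothCircle.calculus u hu, SmoothCircle.continuous_calculus u hM hu,
    SmoothCircle.calculus_coord u hu⟩

/-- A scalar operator is invertible with powers growing polynomially in both directions. -/
theorem IsETScalar.exists_norm_pow_le {S : Y →L[ℂ] Y} (hS : IsETScalar S) :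
    ∃ (R : Y →L[ℂ] Y) (D : ℝ) (K : ℕ), 0 < D ∧ R * S = 1 ∧
      (∀ n : ℕ, ‖S ^ n‖ ≤ D * ((n : ℝ) + 1) ^ K) ∧ ∀ n : ℕ, ‖R ^ n‖ ≤ D * ((n : ℝ) + 1) ^ K := by
  obtain ⟨Φ, hΦ, rfl⟩ := hS
  obtain ⟨K, D, hD, h⟩ := SmoothCircle.exists_norm_le_of_continuous hΦ
  refine ⟨Φ SmoothCircle.coordInv, D, K, hD, ?_, fun n => ?_, fun n => ?_⟩
  · rw [← map_mul, mul_comm, SmoothCircle.coord_mul_coordInv, map_one]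
  · rw [← map_pow]
    simpa using h _ n (SmoothCircle.coord_pow_apply_exp n)
  · rw [← map_pow]
    simpa using h _ (-n) (SmoothCircle.coordInv_pow_apply_exp n)

end Scalar

/-! ### Polynomial growth -/

section Growth

variable {X : Type*} [NormedAddCommGroup X] [NormedSpace ℂ X]

/-- The two-sided polynomial growth condition with a natural exponent, in a form which includes
`n = 0`. -/
structure HasGrowth (T : X →L[ℂ] X) (M : ℝ) (r : ℕ) : Prop where
  one_le : 1 ≤ M
  upper : ∀ (n : ℕ) (x : X), ‖(T ^ n) x‖ ≤ M * ((n : ℝ) + 1) ^ r * ‖x‖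
  lower : ∀ (n : ℕ) (x : X), ‖x‖ ≤ M * ((n : ℝ) + 1) ^ r * ‖(T ^ n) x‖

theorem PolynomialGrowth.exists_hasGrowth {T : X →L[ℂ] X} (hT : PolynomialGrowth T) :
    ∃ M r, HasGrowth T M r := by
  obtain ⟨C, s, hC, hs, h⟩ := hT
  have key : ∀ n : ℕ, 1 ≤ n → C * (n : ℝ) ^ s ≤ max C 1 * ((n : ℝ) + 1) ^ ⌈s⌉₊ := by
    intro n hn
    have hn' : (1 : ℝ) ≤ n := by exact_mod_cast hn
    gcongr
    · exact le_max_left _ _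
    · calc (n : ℝ) ^ s ≤ (n : ℝ) ^ ((⌈s⌉₊ : ℕ) : ℝ) :=
            Real.rpow_le_rpow_of_exponent_le hn' (Nat.le_ceil s)
        _ = (n : ℝ) ^ ⌈s⌉₊ := Real.rpow_natCast _ _
        _ ≤ _ := by gcongr; linarith
  have h0 : ∀ x : X, ‖x‖ ≤ max C 1 * ((0 : ℕ) + 1 : ℝ) ^ ⌈s⌉₊ * ‖x‖ := fun x =>
    le_mul_of_one_le_left (norm_nonneg _) (by simp)
  refine ⟨max C 1, ⌈s⌉₊, le_max_right _ _, fun n x => ?_, fun n x => ?_⟩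
  · rcases Nat.eq_zero_or_pos n with rfl | hn
    · simpa using h0 x
    · exact (h n hn x).2.trans (mul_le_mul_of_nonneg_right (key n hn) (norm_nonneg _))
  · rcases Nat.eq_zero_or_pos n with rfl | hn
    · simpa using h0 x
    · have hpos : 0 < C * (n : ℝ) ^ s := by
        have : (0 : ℝ) < n := by exact_mod_cast hn
        positivity
      have h1 := (h n hn x).1
      rw [one_div, inv_mul_le_iff₀ hpos] at h1
      exact h1.trans (mul_le_mul_of_nonneg_right (key n hn) (norm_nonneg _))

theorem polynomialGrowth_of_le {T : X →L[ℂ] X} {C : ℝ} {K : ℕ}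
    (hu : ∀ (n : ℕ) (x : X), ‖(T ^ n) x‖ ≤ C * ((n : ℝ) + 1) ^ K * ‖x‖)
    (hl : ∀ (n : ℕ) (x : X), ‖x‖ ≤ C * ((n : ℝ) + 1) ^ K * ‖(T ^ n) x‖) :
    PolynomialGrowth T := by
  refine ⟨max C 1 * 2 ^ K, K, by positivity, by positivity, fun n hn x => ?_⟩
  have hn' : (1 : ℝ) ≤ n := by exact_mod_cast hn
  have key : C * ((n : ℝ) + 1) ^ K ≤ max C 1 * 2 ^ K * (n : ℝ) ^ (K : ℝ) := by
    rw [Real.rpow_natCast, mul_assoc, ← mul_pow]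
    gcongr
    · exact le_max_left _ _
    · linarith
  constructor
  · have hpos : 0 < max C 1 * 2 ^ K * (n : ℝ) ^ (K : ℝ) := by positivity
    rw [one_div, inv_mul_le_iff₀ hpos]
    exact (hl n x).trans (by gcongr)
  · exact (hu n x).trans (by gcongr)

theorem restrictInvariant_pow_apply {Y : Type*} [NormedAddCommGroup Y] [NormedSpace ℂ Y]
    (S : Y →L[ℂ] Y) (N : Submodule ℂ Y) (hN : ∀ y ∈ N, S y ∈ N) (n : ℕ) (y : N) :
    (((restrictInvariant S N hN) ^ n) y : Y) = (S ^ n) y := by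
  induction n with
  | zero => rfl
  | succ n ih =>
    rw [pow_succ', pow_succ', mul_apply_eq_comp, mul_apply_eq_comp, ← ih]
    rfl

/-- Polynomial growth is inherited by operators similar to a restriction of a scalar operator. -/
theorem IsETSubscalar.polynomialGrowth {X : Type u} [NormedAddCommGroup X] [NormedSpace ℂ X]
    {T : X →L[ℂ] X} (hT : IsETSubscalar T) : PolynomialGrowth T := by
  obtain ⟨Y, _, _, _, S, hS, N, hN, -, V, hV⟩ := hT
  obtain ⟨R, D, K, hD, hRS, hSn, hRn⟩ := hS.exists_norm_pow_le
  have hVn : ∀ (n : ℕ) (x : X), (V ((T ^ n) x) : Y) = (S ^ n) (V x) := by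
    intro n x
    rw [← restrictInvariant_pow_apply S N hN]
    congr 1
    induction n with
    | zero => rfl
    | succ n ih =>
      rw [pow_succ', pow_succ', mul_apply_eq_comp, mul_apply_eq_comp, hV,
        ih]
  have hRSn : ∀ n : ℕ, R ^ n * S ^ n = 1 := by
    intro n
    induction n with
    | zero => simp
    | succ n ih =>
      rw [pow_succ, pow_succ', mul_assoc, ← mul_assoc R S, hRS, one_mul, ih]
  set a := ‖(V.symm : N →L[ℂ] X)‖ with ha
  set b := ‖(V : X →L[ℂ] N)‖ with hb
  have h1 : ∀ x : X, ‖x‖ ≤ a * ‖(V x : Y)‖ := fun x => by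
    simpa using (V.symm : N →L[ℂ] X).le_opNorm (V x)
  have h2 : ∀ x : X, ‖(V x : Y)‖ ≤ b * ‖x‖ := fun x => (V : X →L[ℂ] N).le_opNorm x
  refine polynomialGrowth_of_le (C := a * b * D) (K := K) (fun n x => ?_) (fun n x => ?_)
  · calc ‖(T ^ n) x‖ ≤ a * ‖(S ^ n) (V x)‖ := by rw [← hVn]; exact h1 _
      _ ≤ a * (D * ((n : ℝ) + 1) ^ K * (b * ‖x‖)) := by
        gcongr
        exact ((S ^ n).le_opNorm _).trans (by gcongr; exacts [hSn n, h2 x])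
      _ = _ := by ring
  · calc ‖x‖ ≤ a * ‖(V x : Y)‖ := h1 x
      _ = a * ‖(R ^ n) ((S ^ n) (V x))‖ := by
        rw [← mul_apply_eq_comp, hRSn]; rfl
      _ ≤ a * (D * ((n : ℝ) + 1) ^ K * (b * ‖(T ^ n) x‖)) := by
        gcongr
        refine ((R ^ n).le_opNorm _).trans ?_
        gcongr
        · exact hRn n
        · rw [← hVn]; exact h2 _
      _ = _ := by ring

/-! ### Sequences satisfying an inhomogeneous recursion -/

theorem pow_apply_eq_add_sum {T : X →L[ℂ] X} {f g : ℕ → X}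
    (h : ∀ n, T (f n) = f (n + 1) + g (n + 1)) (n k : ℕ) :
    (T ^ k) (f n) = f (n + k) + ∑ j ∈ Finset.range k, (T ^ (k - 1 - j)) (g (n + 1 + j)) := by
  induction k with
  | zero => simp
  | succ k ih =>
    rw [pow_succ', mul_apply_eq_comp, ih, map_add, h, Finset.sum_range_succ, map_sum]
    have h1 : ∀ j ∈ Finset.range k, T ((T ^ (k - 1 - j)) (g (n + 1 + j))) =
        (T ^ (k + 1 - 1 - j)) (g (n + 1 + j)) := by
      intro j hj
      have : k + 1 - 1 - j = k - 1 - j + 1 := by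
        have := Finset.mem_range.1 hj
        omega
      rw [this, pow_succ', mul_apply_eq_comp]
    rw [Finset.sum_congr rfl h1]
    have h2 : k + 1 - 1 - k = 0 := by omega
    have h3 : n + 1 + k = n + k + 1 := by ring
    have h4 : n + (k + 1) = n + k + 1 := by ring
    rw [h2, h3, h4, pow_zero, one_apply_eq_self]
    abel

namespace HasGrowth

variable {T : X →L[ℂ] X} {M : ℝ} {r : ℕ}

/-- The cost of `k` steps of the recursion taken at once: the lower bound for `T ^ k` is applied to
`T ^ k fₙ`, and the upper bounds to the terms which arise on the way to `fₙ₊ₖ`. -/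
theorem norm_le_of_recursion (hT : HasGrowth T M r) {f g : ℕ → X}
    (h : ∀ n, T (f n) = f (n + 1) + g (n + 1)) (n k : ℕ) {c : ℝ}
    (hc : M * ((k : ℝ) + 1) ^ r ≤ c) :
    ‖f n‖ ≤ c * ‖f (n + k)‖ + c ^ 2 * ∑ m ∈ Finset.Ico (n + 1) (n + k + 1), ‖g m‖ := by
  have hM := hT.one_le
  have hc0 : 0 ≤ c := le_trans (by positivity) hc
  have h1 : ‖(T ^ k) (f n)‖ ≤ ‖f (n + k)‖ + ∑ j ∈ Finset.range k, c * ‖g (n + 1 + j)‖ := by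
    rw [pow_apply_eq_add_sum h]
    refine (norm_add_le _ _).trans ?_
    gcongr
    refine norm_sum_le_of_le _ fun j hj => (hT.upper _ _).trans ?_
    gcongr
    refine le_trans ?_ hc
    gcongr
    exact_mod_cast (by omega : k - 1 - j ≤ k)
  have h2 : n + k + 1 - (n + 1) = k := by omega
  rw [Finset.sum_Ico_eq_sum_range, h2]
  calc ‖f n‖ ≤ M * ((k : ℝ) + 1) ^ r * ‖(T ^ k) (f n)‖ := hT.lower k _
    _ ≤ c * (‖f (n + k)‖ + ∑ j ∈ Finset.range k, c * ‖g (n + 1 + j)‖) := by gcongr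
    _ = _ := by rw [← Finset.mul_sum]; ring

/-- One squaring step. The number of steps needed to pass from `2` to `n` is only `log log n`, and
in the weight `q ^ K` the loss in the step from `q` to `q ^ 2` is absorbed. -/
theorem weighted_norm_le_sq (hT : HasGrowth T M r) {κ : ℕ} (hκ : M ≤ 2 ^ κ) {f g : ℕ → X}
    (h : ∀ n, T (f n) = f (n + 1) + g (n + 1)) {q : ℕ} (hq : 2 ≤ q) :
    (q : ℝ) ^ (2 * r + κ) * ‖f q‖ ≤ ((q ^ 2 : ℕ) : ℝ) ^ (2 * r + κ) * ‖f (q ^ 2)‖ +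
      ∑ m ∈ Finset.Ico (q + 1) (q ^ 2 + 1), (((m : ℕ) : ℝ) + 1) ^ (3 * (2 * r + κ)) * ‖g m‖ := by
  have hM := hT.one_le
  have hq' : (2 : ℝ) ≤ q := by exact_mod_cast hq
  have hqq : q ≤ q ^ 2 := by nlinarith
  have hk : q + (q ^ 2 - q) = q ^ 2 := by omega
  have hc : M * (((q ^ 2 - q : ℕ) : ℝ) + 1) ^ r ≤ (q : ℝ) ^ (2 * r + κ) := by
    have h1 : (((q ^ 2 - q : ℕ) : ℝ) + 1) ≤ (q : ℝ) ^ 2 := by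
      exact_mod_cast (by omega : q ^ 2 - q + 1 ≤ q ^ 2)
    calc _ ≤ (q : ℝ) ^ κ * ((q : ℝ) ^ 2) ^ r := by
          gcongr
          exact hκ.trans (by gcongr)
      _ = _ := by ring
  have h1 := hT.norm_le_of_recursion h q (q ^ 2 - q) hc
  rw [hk] at h1
  set K := 2 * r + κ
  calc (q : ℝ) ^ K * ‖f q‖
      ≤ (q : ℝ) ^ K * ((q : ℝ) ^ K * ‖f (q ^ 2)‖ +
          ((q : ℝ) ^ K) ^ 2 * ∑ m ∈ Finset.Ico (q + 1) (q ^ 2 + 1), ‖g m‖) := by gcongr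
    _ = ((q ^ 2 : ℕ) : ℝ) ^ K * ‖f (q ^ 2)‖ +
          ∑ m ∈ Finset.Ico (q + 1) (q ^ 2 + 1), (q : ℝ) ^ (3 * K) * ‖g m‖ := by
      rw [← Finset.mul_sum]
      push_cast
      ring
    _ ≤ _ := by
      gcongr with m hm
      have : q + 1 ≤ m := (Finset.mem_Ico.1 hm).1
      have : (q : ℝ) + 1 ≤ m := by exact_mod_cast this
      linarith

theorem norm_zero_le_of_recursion (hT : HasGrowth T M r) {κ : ℕ} (hκ : M ≤ 2 ^ κ) {f g : ℕ → X}
    (h : ∀ n, T (f n) = f (n + 1) + g (n + 1)) (i : ℕ) :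
    ‖f 0‖ ≤ ((2 ^ 2 ^ i : ℕ) : ℝ) ^ (2 * r + κ) * ‖f (2 ^ 2 ^ i)‖ +
      ∑ m ∈ Finset.Ico 1 (2 ^ 2 ^ i + 1), (((m : ℕ) : ℝ) + 1) ^ (3 * (2 * r + κ)) * ‖g m‖ := by
  induction i with
  | zero =>
    have hc : M * (((2 : ℕ) : ℝ) + 1) ^ r ≤ (2 : ℝ) ^ (2 * r + κ) := by
      calc _ ≤ (2 : ℝ) ^ κ * (2 ^ 2) ^ r := by
            have := hT.one_le
            gcongr
            norm_num
        _ = _ := by rw [← pow_mul, ← pow_add, add_comm]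
    have h1 := hT.norm_le_of_recursion h 0 2 hc
    simp only [zero_add] at h1
    norm_num only [pow_zero, pow_one]
    refine h1.trans ?_
    rw [Finset.mul_sum]
    gcongr with m hm
    rw [← pow_mul]
    have hm1 : (1 : ℝ) ≤ m := by exact_mod_cast (Finset.mem_Ico.1 hm).1
    calc (2 : ℝ) ^ ((2 * r + κ) * 2) ≤ 2 ^ (3 * (2 * r + κ)) :=
          pow_le_pow_right₀ (by norm_num) (by omega)
      _ ≤ _ := by gcongr; linarith
  | succ i ih =>
    have hq : 2 ≤ 2 ^ 2 ^ i := by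
      calc 2 = 2 ^ 1 := rfl
        _ ≤ _ := Nat.pow_le_pow_right (by norm_num) Nat.one_le_two_pow
    have h1 := hT.weighted_norm_le_sq hκ h hq
    have h2 : 2 ^ 2 ^ (i + 1) = (2 ^ 2 ^ i) ^ 2 := by rw [← pow_mul, pow_succ]
    rw [h2, ← Finset.sum_Ico_consecutive _ (by omega : 1 ≤ 2 ^ 2 ^ i + 1)
      (by nlinarith : 2 ^ 2 ^ i + 1 ≤ (2 ^ 2 ^ i) ^ 2 + 1)]
    linarith

/-- The key estimate: a vector `x = g₀ + T⁻¹ g₁ + T⁻² g₂ + ⋯` is controlled by the `gₙ` with weights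
growing polynomially in `n`. The relation between `x` and the `gₙ` is expressed by the remainders
`fₙ`, which belong to `X` and tend to `0` fast. -/
theorem exists_norm_le_of_recursion (hT : HasGrowth T M r) :
    ∃ L : ℕ, ∀ (f g : ℕ → X) (D B : ℝ), (∀ n, T (f n) = f (n + 1) + g (n + 1)) →
      (∀ n : ℕ, ((n : ℝ) + 1) ^ L * ‖f n‖ ≤ D) →
      (∀ N, ∑ m ∈ Finset.Ico 1 N, (((m : ℕ) : ℝ) + 1) ^ L * ‖g m‖ ≤ B) → ‖f 0‖ ≤ B := by
  obtain ⟨κ, hκ⟩ := pow_unbounded_of_one_lt M (by norm_num : (1 : ℝ) < 2)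
  set K := 2 * r + κ with hK
  refine ⟨3 * K + 1, fun f g D B h hD hB => ?_⟩
  -- the spare factor `q + 1` in the decay of `f q` makes the remainder at `q = 2 ^ 2 ^ i` tend to `0`
  have key : ∀ i : ℕ, ‖f 0‖ ≤ D * (1 / ((i : ℝ) + 1)) + B := by
    intro i
    refine (hT.norm_zero_le_of_recursion hκ.le h i).trans (add_le_add ?_ ?_)
    · set q : ℕ := 2 ^ 2 ^ i with hq
      have hqi : (i : ℝ) + 1 ≤ q + 1 := by
        have : i ≤ q := (Nat.lt_two_pow_self.trans Nat.lt_two_pow_self).le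
        gcongr
      rw [mul_one_div, le_div_iff₀ (by positivity)]
      calc (q : ℝ) ^ K * ‖f q‖ * (i + 1) ≤ ((q : ℝ) + 1) ^ (3 * K) * ‖f q‖ * (q + 1) := by
            gcongr
            calc (q : ℝ) ^ K ≤ ((q : ℝ) + 1) ^ K := by gcongr; linarith
              _ ≤ _ := pow_le_pow_right₀ (by linarith [q.cast_nonneg (α := ℝ)]) (by omega)
        _ = ((q : ℝ) + 1) ^ (3 * K + 1) * ‖f q‖ := by ring
        _ ≤ D := hD q
    · refine le_trans ?_ (hB (2 ^ 2 ^ i + 1))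
      gcongr
      · linarith [Nat.cast_nonneg (α := ℝ) ‹ℕ›]
      · omega
  have hlim : Tendsto (fun i : ℕ => D * (1 / ((i : ℝ) + 1)) + B) atTop (𝓝 (D * 0 + B)) :=
    (tendsto_one_div_add_atTop_nhds_zero_nat.const_mul D).add_const B
  rw [mul_zero, zero_add] at hlim
  exact ge_of_tendsto' hlim key

end HasGrowth

end Growth

/-! ### Spectra -/

theorem norm_le_one_of_mem_spectrum {A : Type*} [NormedRing A] [NormedAlgebra ℂ A]
    [CompleteSpace A] {a : A} {M : ℝ} {r : ℕ} (ha : ∀ n : ℕ, ‖a ^ n‖ ≤ M * ((n : ℝ) + 1) ^ r)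
    {z : ℂ} (hz : z ∈ spectrum ℂ a) : ‖z‖ ≤ 1 := by
  by_contra! hlt
  have h1 : ∀ n : ℕ, 1 ≤ M * ‖(1 : A)‖ * ‖z‖ *
      (((n + 1 : ℕ) : ℝ) ^ r / ‖z‖ ^ (n + 1)) := by
    intro n
    have h2 : ‖z‖ ^ n ≤ M * ((n : ℝ) + 1) ^ r * ‖(1 : A)‖ := by
      rw [← norm_pow]
      exact (spectrum.norm_le_norm_mul_of_mem (spectrum.pow_mem_pow a n hz)).trans
        (by gcongr; exact ha n)
    have h3 : 0 < ‖z‖ := one_pos.trans hlt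
    rw [← mul_div_assoc, le_div_iff₀ (by positivity), one_mul, pow_succ]
    push_cast
    nlinarith
  have h2 := ((tendsto_pow_const_div_const_pow_of_one_lt r hlt).comp
    (tendsto_add_atTop_nat 1)).const_mul (M * ‖(1 : A)‖ * ‖z‖)
  rw [mul_zero] at h2
  exact absurd (ge_of_tendsto' h2 h1) (by norm_num)

theorem one_le_norm_of_mem_spectrum {A : Type*} [NormedRing A] [NormedAlgebra ℂ A]
    [CompleteSpace A] {a b : A} (hab : a * b = 1) (hba : b * a = 1) {M : ℝ} {r : ℕ}
    (hb : ∀ n : ℕ, ‖b ^ n‖ ≤ M * ((n : ℝ) + 1) ^ r) {z : ℂ} (hz : z ∈ spectrum ℂ a) :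
    1 ≤ ‖z‖ := by
  let u : Aˣ := ⟨a, b, hab, hba⟩
  have hz0 : z ≠ 0 := by
    rintro rfl
    exact (spectrum.zero_mem_iff ℂ).1 hz u.isUnit
  have h1 : z⁻¹ ∈ spectrum ℂ ((u⁻¹ : Aˣ) : A) := spectrum.inv₀_mem_inv (a := u) hz
  have h2 := norm_le_one_of_mem_spectrum (a := ((u⁻¹ : Aˣ) : A)) hb h1
  rw [norm_inv] at h2
  exact (inv_le_one₀ (norm_pos_iff.2 hz0)).1 h2

section Spectra

variable {X : Type*} [NormedAddCommGroup X] [NormedSpace ℂ X] {T : X →L[ℂ] X}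

theorem exists_forall_le_of_notMem_approxPointSpectrum {z : ℂ} (hz : z ∉ approxPointSpectrum T) :
    ∃ ε > 0, ∀ x, ε * ‖x‖ ≤ ‖T x - z • x‖ := by
  simp only [approxPointSpectrum, Set.mem_ofPred_eq] at hz
  push Not at hz
  obtain ⟨ε, hε, h⟩ := hz
  refine ⟨ε, hε, fun x => ?_⟩
  rcases eq_or_ne x 0 with rfl | hx
  · simp
  have hx' : 0 < ‖x‖ := norm_pos_iff.2 hx
  have hc : ‖((‖x‖⁻¹ : ℝ) : ℂ)‖ = ‖x‖⁻¹ := by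
    rw [Complex.norm_real, Real.norm_of_nonneg (by positivity)]
  have h1 := h (((‖x‖⁻¹ : ℝ) : ℂ) • x) (by
    rw [norm_smul, hc]
    exact inv_mul_cancel₀ hx'.ne')
  rw [map_smul, smul_comm z, ← smul_sub, norm_smul, hc, inv_mul_eq_div, le_div_iff₀ hx'] at h1
  exact h1

/-- For an operator with spectrum in the closed unit disc, a point outside the open disc which is
not in the approximate point spectrum is not in the spectrum either: it is a limit of points of
the resolvent set at which the resolvent is uniformly bounded. -/
theorem notMem_spectrum_of_notMem_approxPointSpectrum [CompleteSpace X] {M : ℝ} {r : ℕ}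
    (hT : ∀ n : ℕ, ‖T ^ n‖ ≤ M * ((n : ℝ) + 1) ^ r) {z : ℂ} (hz1 : 1 ≤ ‖z‖)
    (hz : z ∉ approxPointSpectrum T) : z ∉ spectrum ℂ T := by
  obtain ⟨ε, hε, h⟩ := exists_forall_le_of_notMem_approxPointSpectrum hz
  have hz0 : 0 < ‖z‖ := one_pos.trans_le hz1
  -- the point `(1 + t) z` is outside the disc, at distance `ε / 3` from `z`
  set t : ℝ := ε / (3 * ‖z‖) with ht
  have ht0 : 0 < t := by positivity
  have htz : t * ‖z‖ = ε / 3 := by rw [ht]; field_simp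
  have hw : ((1 + t : ℝ) : ℂ) * z ∉ spectrum ℂ T := fun hmem => by
    have h1 := norm_le_one_of_mem_spectrum hT hmem
    rw [norm_mul, Complex.norm_real, Real.norm_of_nonneg (by positivity)] at h1
    nlinarith
  rw [spectrum.notMem_iff] at hw
  obtain ⟨U, hU⟩ := hw
  have hUx : ∀ x, (U : X →L[ℂ] X) x = z • x - T x + (t * z : ℂ) • x := by
    intro x
    rw [hU, sub_apply, Algebra.algebraMap_eq_smul_one,
      smul_apply, one_apply_eq_self]
    push_cast
    rw [add_mul, one_mul, add_smul]
    abel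
  have hlow : ∀ x, ε * (2 / 3) * ‖x‖ ≤ ‖(U : X →L[ℂ] X) x‖ := by
    intro x
    have h1 := norm_sub_norm_le (z • x - T x) (-((t * z : ℂ) • x))
    rw [sub_neg_eq_add, ← hUx, norm_neg, norm_smul, norm_mul, Complex.norm_real,
      Real.norm_of_nonneg ht0.le, htz, norm_sub_rev] at h1
    linarith [h x]
  have hinv : ‖((U⁻¹ : (X →L[ℂ] X)ˣ) : X →L[ℂ] X)‖ ≤ (ε * (2 / 3))⁻¹ := by
    refine ContinuousLinearMap.opNorm_le_bound _ (by positivity) fun y => ?_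
    have h1 := hlow (((U⁻¹ : (X →L[ℂ] X)ˣ) : X →L[ℂ] X) y)
    rw [← mul_apply_eq_comp, U.mul_inv, one_apply_eq_self] at h1
    rwa [inv_mul_eq_div, le_div_iff₀ (by positivity), mul_comm]
  have hsmall : ‖(t * z : ℂ) • ((U⁻¹ : (X →L[ℂ] X)ˣ) : X →L[ℂ] X)‖ < 1 := by
    rw [norm_smul, norm_mul, Complex.norm_real, Real.norm_of_nonneg ht0.le, htz]
    calc _ ≤ ε / 3 * (ε * (2 / 3))⁻¹ := by gcongr
      _ = 1 / 2 := by field_simp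
      _ < 1 := by norm_num
  rw [spectrum.notMem_iff]
  have heq : algebraMap ℂ (X →L[ℂ] X) z - T =
      U * (1 - (t * z : ℂ) • ((U⁻¹ : (X →L[ℂ] X)ˣ) : X →L[ℂ] X)) := by
    rw [mul_sub, mul_one, mul_smul_comm, U.mul_inv]
    ext x
    rw [sub_apply, sub_apply, hUx,
      Algebra.algebraMap_eq_smul_one, smul_apply,
      smul_apply, one_apply_eq_self]
    abel
  rw [heq]
  exact U.isUnit.mul (isUnit_one_sub_of_norm_lt_one hsmall)

theorem approxPointSpectrum_subset_spectrum_of_intertwining {Y : Type*} [NormedAddCommGroup Y]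
    [NormedSpace ℂ Y] {S : Y →L[ℂ] Y} (π : X →L[ℂ] Y) {c : ℝ} (hπ : ∀ x, ‖x‖ ≤ c * ‖π x‖)
    (hST : ∀ x, S (π x) = π (T x)) : approxPointSpectrum T ⊆ spectrum ℂ S := by
  intro z hz hu
  obtain ⟨U, hU⟩ := (show IsUnit (algebraMap ℂ (Y →L[ℂ] Y) z - S) from hu)
  set a := max c 1 * (‖((U⁻¹ : (Y →L[ℂ] Y)ˣ) : Y →L[ℂ] Y)‖ * (‖π‖ + 1)) + 1 with ha
  have ha0 : 0 < a := by positivity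
  obtain ⟨x, hx, hlt⟩ := hz a⁻¹ (by positivity)
  have hUx : (U : Y →L[ℂ] Y) (π x) = π (z • x - T x) := by
    rw [hU, sub_apply, Algebra.algebraMap_eq_smul_one,
      smul_apply, one_apply_eq_self, map_sub, map_smul, hST]
  have h1 : π x = ((U⁻¹ : (Y →L[ℂ] Y)ˣ) : Y →L[ℂ] Y) (π (z • x - T x)) := by
    rw [← hUx, ← mul_apply_eq_comp, U.inv_mul, one_apply_eq_self]
  have h2 : ‖x‖ ≤ (a - 1) * ‖T x - z • x‖ := by
    calc ‖x‖ ≤ max c 1 * ‖π x‖ := (hπ x).trans (by gcongr; exact le_max_left _ _)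
      _ ≤ max c 1 * (‖((U⁻¹ : (Y →L[ℂ] Y)ˣ) : Y →L[ℂ] Y)‖ * ((‖π‖ + 1) * ‖T x - z • x‖)) := by
        gcongr
        rw [h1]
        refine (ContinuousLinearMap.le_opNorm _ _).trans ?_
        gcongr
        refine (ContinuousLinearMap.le_opNorm _ _).trans ?_
        rw [norm_sub_rev]
        gcongr
        linarith
      _ = _ := by rw [ha]; ring
  rw [hx] at h2
  have h3 : (a - 1) * ‖T x - z • x‖ ≤ a * ‖T x - z • x‖ := by gcongr; linarith
  have h4 : a * ‖T x - z • x‖ < a * a⁻¹ := by gcongr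
  rw [mul_inv_cancel₀ ha0.ne'] at h4
  linarith

end Spectra

/-! ### Operators on quotients -/

section Quotient

variable {E : Type*} [NormedAddCommGroup E] [NormedSpace ℂ E]

/-- The quotient of `E` by a closed subspace `N`. It is a type of its own, so that its only topology
is that of the quotient norm. -/
def ClosedQuotient (N : Submodule ℂ E) : Type _ := E ⧸ N

namespace ClosedQuotient

variable {N : Submodule ℂ E} [IsClosed (N : Set E)]

noncomputable instance : NormedAddCommGroup (ClosedQuotient N) :=
  inferInstanceAs (NormedAddCommGroup (E ⧸ N))

noncomputable instance : NormedSpace ℂ (ClosedQuotient N) :=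
  inferInstanceAs (NormedSpace ℂ (E ⧸ N))

instance [CompleteSpace E] : CompleteSpace (ClosedQuotient N) :=
  inferInstanceAs (CompleteSpace (E ⧸ N))

variable (N) in
/-- The quotient map. -/
noncomputable def mk : E →L[ℂ] ClosedQuotient N :=
  LinearMap.mkContinuous (E := E) (F := ClosedQuotient N) N.mkQ 1 fun x => by
    rw [one_mul]
    exact Submodule.Quotient.norm_mk_le N x

theorem norm_mk_le (x : E) : ‖mk N x‖ ≤ ‖x‖ := Submodule.Quotient.norm_mk_le N x

theorem mk_surjective : Function.Surjective (mk N) := Submodule.Quotient.mk_surjective N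

theorem mk_eq_mk {x y : E} : mk N x = mk N y ↔ x - y ∈ N := Submodule.Quotient.eq N

theorem exists_norm_lt (y : ClosedQuotient N) {ε : ℝ} (hε : 0 < ε) :
    ∃ x, mk N x = y ∧ ‖x‖ < ‖y‖ + ε :=
  Submodule.Quotient.norm_mk_lt (S := N) y hε

theorem ext_mk {F : Type*} [NormedAddCommGroup F] [NormedSpace ℂ F]
    {A B : ClosedQuotient N →L[ℂ] F} (h : ∀ x, A (mk N x) = B (mk N x)) : A = B := by
  ext y
  obtain ⟨x, rfl⟩ := mk_surjective y
  exact h x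

theorem norm_le_of_forall_mk {F : Type*} [NormedAddCommGroup F] {B : ClosedQuotient N → F} {C : ℝ}
    (hC : 0 ≤ C) (h : ∀ x, ‖B (mk N x)‖ ≤ C * ‖x‖) (y : ClosedQuotient N) : ‖B y‖ ≤ C * ‖y‖ := by
  refine le_of_forall_pos_le_add fun ε hε => ?_
  obtain ⟨x, rfl, hx⟩ := exists_norm_lt y (show 0 < ε / (C + 1) by positivity)
  calc _ ≤ C * ‖x‖ := h x
    _ ≤ C * (‖mk N x‖ + ε / (C + 1)) := by gcongr
    _ = C * ‖mk N x‖ + C * (ε / (C + 1)) := by ring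
    _ ≤ _ := by
      gcongr
      rw [mul_div_assoc', div_le_iff₀ (by positivity)]
      nlinarith

end ClosedQuotient

open ClosedQuotient

/-- The operator on the quotient by `N` induced by an operator which maps `N` into itself. -/
noncomputable def quotientOperator (N : Submodule ℂ E) [IsClosed (N : Set E)] (A : E →L[ℂ] E)
    (hA : ∀ x ∈ N, A x ∈ N) : ClosedQuotient N →L[ℂ] ClosedQuotient N :=
  LinearMap.mkContinuous (E := ClosedQuotient N) (F := ClosedQuotient N)
    (N.mapQ N (A : E →ₗ[ℂ] E) hA) ‖A‖
    (norm_le_of_forall_mk (norm_nonneg _) fun x => (norm_mk_le (A x)).trans (A.le_opNorm x))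

variable {N : Submodule ℂ E} [IsClosed (N : Set E)] {A B : E →L[ℂ] E}

theorem quotientOperator_mk (hA : ∀ x ∈ N, A x ∈ N) (x : E) :
    quotientOperator N A hA (mk N x) = mk N (A x) := rfl

theorem quotientOperator_pow_mk (hA : ∀ x ∈ N, A x ∈ N) (n : ℕ) (x : E) :
    ((quotientOperator N A hA) ^ n) (mk N x) = mk N ((A ^ n) x) := by
  induction n with
  | zero => rfl
  | succ n ih =>
    rw [pow_succ', pow_succ', mul_apply_eq_comp, mul_apply_eq_comp, ih, quotientOperator_mk]

theorem norm_quotientOperator_pow_le (hA : ∀ x ∈ N, A x ∈ N) (n : ℕ) :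
    ‖(quotientOperator N A hA) ^ n‖ ≤ ‖A ^ n‖ := by
  refine ContinuousLinearMap.opNorm_le_bound _ (norm_nonneg _)
    (norm_le_of_forall_mk (norm_nonneg _) fun x => ?_)
  rw [quotientOperator_pow_mk]
  exact (norm_mk_le _).trans (ContinuousLinearMap.le_opNorm _ _)

theorem notMem_spectrum_quotientOperator (hA : ∀ x ∈ N, A x ∈ N) {Q : E →L[ℂ] E}
    (hQ : ∀ x ∈ N, Q x ∈ N) {z : ℂ} (h₁ : Q * (z • 1 - A) = 1) (h₂ : (z • 1 - A) * Q = 1) :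
    z ∉ spectrum ℂ (quotientOperator N A hA) := by
  rw [spectrum.notMem_iff, Algebra.algebraMap_eq_smul_one]
  refine ⟨⟨z • 1 - quotientOperator N A hA, quotientOperator N Q hQ, ?_, ?_⟩, rfl⟩
  · exact ext_mk fun x => congrArg (mk N) (DFunLike.congr_fun h₂ x)
  · exact ext_mk fun x => congrArg (mk N) (DFunLike.congr_fun h₁ x)

/-- Commuting operators `A` and `B` which are inverse to each other modulo `N` and whose powers grow
polynomially induce mutually inverse scalar operators on the quotient by `N`. -/
theorem isETScalar_quotientOperator [CompleteSpace E]
    (hA : ∀ x ∈ N, A x ∈ N) (hB : ∀ x ∈ N, B x ∈ N) (hAB : A * B = B * A)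
    (hN : ∀ x, x - B (A x) ∈ N) {M : ℝ} {r : ℕ} (hAn : ∀ n : ℕ, ‖A ^ n‖ ≤ M * ((n : ℝ) + 1) ^ r)
    (hBn : ∀ n : ℕ, ‖B ^ n‖ ≤ M * ((n : ℝ) + 1) ^ r) :
    IsUnit (quotientOperator N A hA) ∧ IsETScalar (quotientOperator N A hA) ∧
      ∀ z ∈ spectrum ℂ (quotientOperator N A hA), 1 ≤ ‖z‖ := by
  have hBA' : quotientOperator N B hB * quotientOperator N A hA = 1 :=
    ext_mk fun x => (mk_eq_mk.2 (hN x)).symm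
  have hAB' : quotientOperator N A hA * quotientOperator N B hB = 1 := by
    rw [← hBA']
    exact ext_mk fun x => congrArg (mk N) (DFunLike.congr_fun hAB x)
  have hAn' := fun n => (norm_quotientOperator_pow_le hA n).trans (hAn n)
  have hBn' := fun n => (norm_quotientOperator_pow_le hB n).trans (hBn n)
  exact ⟨⟨⟨_, _, hAB', hBA'⟩, rfl⟩, isETScalar_of_norm_pow_le hAB' hBA' hAn' hBn',
    fun z hz => one_le_norm_of_mem_spectrum hAB' hBA' hBn' hz⟩

theorem mem_closure_range_of_commute {J A : E →L[ℂ] E} (h : A * J = J * A) :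
    ∀ x ∈ J.range.topologicalClosure, A x ∈ J.range.topologicalClosure := by
  intro x hx
  refine map_mem_closure A.continuous hx fun y hy => ?_
  obtain ⟨z, rfl⟩ := hy
  exact ⟨A z, (DFunLike.congr_fun h z).symm⟩

instance isClosed_topologicalClosure_range (J : E →L[ℂ] E) :
    IsClosed (J.range.topologicalClosure : Set E) :=
  Submodule.isClosed_topologicalClosure _

theorem le_norm_mk_closure_range {J : E →L[ℂ] E} {x : E} {c : ℝ} (h : ∀ z, c ≤ ‖x - J z‖) :
    c ≤ ‖mk J.range.topologicalClosure x‖ := by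
  refine le_of_forall_pos_le_add fun ε hε => ?_
  obtain ⟨y, hy, hlt⟩ := exists_norm_lt (mk J.range.topologicalClosure x) hε
  have hmem : x - y ∈ closure (J.range : Set E) := mk_eq_mk.1 hy.symm
  have hcl : IsClosed {z : E | c ≤ ‖x - z‖} := by
    apply isClosed_le <;> fun_prop
  have h1 : x - y ∈ {z : E | c ≤ ‖x - z‖} := by
    refine closure_minimal ?_ hcl hmem
    rintro _ ⟨z, rfl⟩
    exact h z
  have h2 : c ≤ ‖x - (x - y)‖ := h1
  rw [sub_sub_cancel] at h2
  exact h2.trans hlt.le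

end Quotient

/-! ### Shifts on `ℓ_p(ℕ, X)` -/

section Shift

variable {X : Type*} [NormedAddCommGroup X] {p : ℝ≥0∞}

theorem lp_single_zero_apply_succ (x : X) (n : ℕ) :
    (lp.single p 0 x : lp (fun _ : ℕ => X) p) (n + 1) = 0 :=
  lp.single_apply_ne (E := fun _ : ℕ => X) p 0 x n.succ_ne_zero

theorem lp_single_zero_apply_zero (x : X) :
    (lp.single p 0 x : lp (fun _ : ℕ => X) p) 0 = x :=
  lp.single_apply_self (E := fun _ : ℕ => X) p 0 x

variable [Fact (1 ≤ p)]

theorem toReal_pos_of_one_le (hp : p ≠ ⊤) : 0 < p.toReal :=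
  ENNReal.toReal_pos (one_pos.trans_le Fact.out).ne' hp

theorem memℓp_of_norm_add_le (hp : p ≠ ⊤) {k : ℕ} {D : ℝ} {h : ℕ → X}
    (f : lp (fun _ : ℕ => X) p) (hle : ∀ n, ‖h (n + k)‖ ≤ D * ‖f n‖) : Memℓp h p := by
  have hp0 := toReal_pos_of_one_le hp
  rw [memℓp_gen_iff hp0, ← summable_nat_add_iff k]
  refine Summable.of_nonneg_of_le (fun n => by positivity) (fun n => ?_)
    (((memℓp_gen_iff hp0).1 (lp.memℓp f)).mul_left (|D| ^ p.toReal))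
  rw [← Real.mul_rpow (abs_nonneg _) (norm_nonneg _)]
  gcongr
  exact (hle n).trans (by gcongr; exact le_abs_self D)

theorem lp_norm_le_of_shift (hp : p ≠ ⊤) {k : ℕ} {D : ℝ} (hD : 0 ≤ D)
    {f h : lp (fun _ : ℕ => X) p} (hz : ∀ m < k, h m = 0) (hle : ∀ n, ‖h (n + k)‖ ≤ D * ‖f n‖) :
    ‖h‖ ≤ D * ‖f‖ := by
  have hp0 := toReal_pos_of_one_le hp
  rw [← Real.rpow_le_rpow_iff (norm_nonneg _) (by positivity) hp0,
    Real.mul_rpow hD (norm_nonneg _), lp.norm_rpow_eq_tsum hp0, lp.norm_rpow_eq_tsum hp0,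
    ← tsum_mul_left]
  have hs := (memℓp_gen_iff hp0).1 (lp.memℓp h)
  have hs' := (memℓp_gen_iff hp0).1 (lp.memℓp f)
  have h0 : ∑ m ∈ Finset.range k, ‖h m‖ ^ p.toReal = 0 := by
    refine Finset.sum_eq_zero fun m hm => ?_
    rw [hz m (Finset.mem_range.1 hm), norm_zero, Real.zero_rpow hp0.ne']
  rw [← hs.sum_add_tsum_nat_add k, h0, zero_add]
  refine Summable.tsum_le_tsum (fun n => ?_) ((summable_nat_add_iff k).2 hs) (hs'.mul_left _)
  rw [← Real.mul_rpow hD (norm_nonneg _)]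
  gcongr
  exact hle n

variable [NormedSpace ℂ X]

/-- The operator on `ℓ_p(ℕ, X)` which maps `x` in position `n` to `A n x` in position `n + k`. -/
noncomputable def lpShift (hp : p ≠ ⊤) (k : ℕ) (A : ℕ → X →L[ℂ] X) {D : ℝ}
    (hA : ∀ n, ‖A n‖ ≤ D) : lp (fun _ : ℕ => X) p →L[ℂ] lp (fun _ : ℕ => X) p :=
  LinearMap.mkContinuous
    { toFun := fun f => ⟨fun m => if k ≤ m then A (m - k) (f (m - k)) else 0,
        memℓp_of_norm_add_le (k := k) (D := D) hp f fun n => by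
          rw [if_pos (by omega), Nat.add_sub_cancel]
          exact (A n).le_of_opNorm_le (hA n) _⟩
      map_add' := fun f g => Subtype.ext <| funext fun m => by
        change (if k ≤ m then A (m - k) (f (m - k) + g (m - k)) else 0) =
          (if k ≤ m then A (m - k) (f (m - k)) else 0) + if k ≤ m then A (m - k) (g (m - k)) else 0
        by_cases h : k ≤ m <;> simp [h]
      map_smul' := fun c f => Subtype.ext <| funext fun m => by
        change (if k ≤ m then A (m - k) (c • f (m - k)) else 0) =
          c • if k ≤ m then A (m - k) (f (m - k)) else 0
        by_cases h : k ≤ m <;> simp [h] }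
    D (fun f => lp_norm_le_of_shift (k := k) hp ((norm_nonneg _).trans (hA 0))
      (fun m hm => if_neg (by omega)) fun n => by
        change ‖(if k ≤ n + k then A (n + k - k) (f (n + k - k)) else 0)‖ ≤ _
        rw [if_pos (by omega), Nat.add_sub_cancel]
        exact (A n).le_of_opNorm_le (hA n) _)

theorem lpShift_apply (hp : p ≠ ⊤) (k : ℕ) (A : ℕ → X →L[ℂ] X) {D : ℝ} (hA : ∀ n, ‖A n‖ ≤ D)
    (f : lp (fun _ : ℕ => X) p) (m : ℕ) :
    lpShift hp k A hA f m = if k ≤ m then A (m - k) (f (m - k)) else 0 := rfl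

/-- The operator acting as `A` in every coordinate. -/
noncomputable def lpDiag (hp : p ≠ ⊤) (A : X →L[ℂ] X) :
    lp (fun _ : ℕ => X) p →L[ℂ] lp (fun _ : ℕ => X) p :=
  lpShift hp 0 (fun _ => A) (fun _ => le_rfl)

theorem lpDiag_apply (hp : p ≠ ⊤) (A : X →L[ℂ] X) (f : lp (fun _ : ℕ => X) p) (m : ℕ) :
    lpDiag hp A f m = A (f m) := by
  simp [lpDiag, lpShift_apply]

theorem lpDiag_pow_apply (hp : p ≠ ⊤) (A : X →L[ℂ] X) (k : ℕ) (f : lp (fun _ : ℕ => X) p)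
    (m : ℕ) : ((lpDiag hp A) ^ k) f m = (A ^ k) (f m) := by
  induction k with
  | zero => rfl
  | succ k ih => rw [pow_succ', pow_succ', mul_apply_eq_comp, mul_apply_eq_comp, lpDiag_apply, ih]

theorem norm_lpDiag_pow_le (hp : p ≠ ⊤) (A : X →L[ℂ] X) (k : ℕ) :
    ‖(lpDiag (p := p) hp A) ^ k‖ ≤ ‖A ^ k‖ := by
  refine ContinuousLinearMap.opNorm_le_bound _ (norm_nonneg _) fun f => ?_
  refine lp_norm_le_of_shift (k := 0) hp (norm_nonneg _) (fun m hm => absurd hm (by omega))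
    fun n => ?_
  rw [add_zero, lpDiag_pow_apply]
  exact ContinuousLinearMap.le_opNorm _ _

/-- The right shift on `ℓ_p(ℕ, X)` with weights `((n + 2) / (n + 1)) ^ L`, that is, the unweighted
shift when `ℓ_p(ℕ, X)` carries the weight sequence `(n + 1) ^ L`. -/
noncomputable def polyShift (X : Type*) [NormedAddCommGroup X] [NormedSpace ℂ X] (hp : p ≠ ⊤)
    (L : ℕ) : lp (fun _ : ℕ => X) p →L[ℂ] lp (fun _ : ℕ => X) p :=
  lpShift (D := 2 ^ L) hp 1
    (fun n => ((((n : ℝ) + 2) / ((n : ℝ) + 1)) ^ L : ℝ) • ContinuousLinearMap.id ℂ X) (fun n => by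
      rw [norm_smul, Real.norm_of_nonneg (by positivity)]
      refine (mul_le_of_le_one_right (by positivity) ContinuousLinearMap.norm_id_le).trans ?_
      gcongr
      rw [div_le_iff₀ (by positivity)]
      linarith [n.cast_nonneg (α := ℝ)])

theorem polyShift_apply_zero (hp : p ≠ ⊤) (L : ℕ) (f : lp (fun _ : ℕ => X) p) :
    polyShift X hp L f 0 = 0 := by
  rw [polyShift, lpShift_apply, if_neg (by omega)]

theorem polyShift_apply_succ (hp : p ≠ ⊤) (L : ℕ) (f : lp (fun _ : ℕ => X) p) (n : ℕ) :
    polyShift X hp L f (n + 1) = ((((n : ℝ) + 2) / ((n : ℝ) + 1)) ^ L : ℝ) • f n := by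
  rw [polyShift, lpShift_apply, if_pos (by omega), Nat.add_sub_cancel]
  rfl

theorem polyShift_pow_apply_of_lt (hp : p ≠ ⊤) (L k : ℕ) (f : lp (fun _ : ℕ => X) p) {m : ℕ}
    (hm : m < k) : ((polyShift X hp L) ^ k) f m = 0 := by
  induction k generalizing m with
  | zero => omega
  | succ k ih =>
    rw [pow_succ', mul_apply_eq_comp]
    rcases m with _ | m
    · exact polyShift_apply_zero hp L _
    · rw [polyShift_apply_succ, ih (by omega), smul_zero]

theorem polyShift_pow_apply_add (hp : p ≠ ⊤) (L k : ℕ) (f : lp (fun _ : ℕ => X) p) (n : ℕ) :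
    ((polyShift X hp L) ^ k) f (n + k) =
      ((((n : ℝ) + k + 1) / ((n : ℝ) + 1)) ^ L : ℝ) • f n := by
  induction k with
  | zero =>
    have : (n : ℝ) + 1 ≠ 0 := by positivity
    simp [div_self this]
  | succ k ih =>
    rw [pow_succ', mul_apply_eq_comp, ← add_assoc, polyShift_apply_succ, ih, smul_smul, ← mul_pow]
    congr 2
    have : (n : ℝ) + 1 ≠ 0 := by positivity
    have : (n : ℝ) + k + 1 ≠ 0 := by positivity
    push_cast
    field_simp
    ring

theorem norm_polyShift_pow_le (hp : p ≠ ⊤) (L k : ℕ) :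
    ‖(polyShift (p := p) X hp L) ^ k‖ ≤ ((k : ℝ) + 1) ^ L := by
  refine ContinuousLinearMap.opNorm_le_bound _ (by positivity) fun f => ?_
  refine lp_norm_le_of_shift (k := k) hp (by positivity)
    (fun m hm => polyShift_pow_apply_of_lt hp L k f hm) fun n => ?_
  rw [polyShift_pow_apply_add, norm_smul, Real.norm_of_nonneg (by positivity)]
  gcongr
  rw [div_le_iff₀ (by positivity)]
  nlinarith [n.cast_nonneg (α := ℝ), k.cast_nonneg (α := ℝ)]

theorem lpDiag_mul_polyShift (hp : p ≠ ⊤) (L : ℕ) (A : X →L[ℂ] X) :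
    lpDiag (p := p) hp A * polyShift X hp L = polyShift X hp L * lpDiag hp A := by
  ext f m
  rw [mul_apply_eq_comp, mul_apply_eq_comp, lpDiag_apply]
  rcases m with _ | m
  · rw [polyShift_apply_zero, polyShift_apply_zero, map_zero]
  · rw [polyShift_apply_succ, polyShift_apply_succ, lpDiag_apply, ContinuousLinearMap.map_smul_of_tower]

theorem lpDiag_smul_one_sub (hp : p ≠ ⊤) (z : ℂ) (A : X →L[ℂ] X) :
    lpDiag (p := p) hp (z • 1 - A) = z • 1 - lpDiag hp A := by
  refine ContinuousLinearMap.ext fun f => Subtype.ext <| funext fun m => ?_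
  change lpDiag hp (z • 1 - A) f m = z • f m - lpDiag hp A f m
  rw [lpDiag_apply, lpDiag_apply]
  rfl

theorem lpDiag_one (hp : p ≠ ⊤) : lpDiag (p := p) hp (1 : X →L[ℂ] X) = 1 :=
  ContinuousLinearMap.ext fun f => Subtype.ext <| funext fun m => lpDiag_apply hp 1 f m

theorem lpDiag_single (hp : p ≠ ⊤) (A : X →L[ℂ] X) (x : X) :
    lpDiag hp A (lp.single p 0 x) = lp.single p 0 (A x) := by
  refine Subtype.ext <| funext fun m => (lpDiag_apply hp A _ m).trans ?_
  rcases m with _ | m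
  · exact (congrArg A (lp_single_zero_apply_zero x)).trans (lp_single_zero_apply_zero _).symm
  · exact (congrArg A (lp_single_zero_apply_succ x m)).trans
      ((map_zero A).trans (lp_single_zero_apply_succ _ m).symm)

theorem lpDiag_mul (hp : p ≠ ⊤) (A B : X →L[ℂ] X) :
    lpDiag (p := p) hp (A * B) = lpDiag hp A * lpDiag hp B := by
  ext f m
  rw [mul_apply_eq_comp, lpDiag_apply, lpDiag_apply, lpDiag_apply, mul_apply_eq_comp]

end Shift

/-! ### The scalar extension -/

section Extension

variable {X : Type*} [NormedAddCommGroup X] [NormedSpace ℂ X] {p : ℝ≥0∞} [Fact (1 ≤ p)]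

/-- The operator `1 - B D` on `ℓ_p(ℕ, X)`, where `D` is `T` acting in every coordinate and `B` is
the right shift. Modulo its range `B` is inverse to `D`. -/
noncomputable def relationOperator (hp : p ≠ ⊤) (L : ℕ) (T : X →L[ℂ] X) :
    lp (fun _ : ℕ => X) p →L[ℂ] lp (fun _ : ℕ => X) p :=
  1 - polyShift X hp L * lpDiag hp T

theorem commute_polyShift_relationOperator (hp : p ≠ ⊤) (L : ℕ) (T : X →L[ℂ] X) :
    polyShift X hp L * relationOperator (p := p) hp L T =
      relationOperator hp L T * polyShift X hp L := by
  rw [relationOperator, mul_sub, sub_mul, mul_one, one_mul, mul_assoc, lpDiag_mul_polyShift]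

theorem commute_lpDiag_relationOperator (hp : p ≠ ⊤) (L : ℕ) {T A : X →L[ℂ] X}
    (hA : A * T = T * A) :
    lpDiag hp A * relationOperator (p := p) hp L T = relationOperator hp L T * lpDiag hp A := by
  rw [relationOperator, mul_sub, sub_mul, mul_one, one_mul, mul_assoc, ← mul_assoc (lpDiag hp A),
    lpDiag_mul_polyShift, mul_assoc, ← lpDiag_mul, ← lpDiag_mul, hA]

theorem relationOperator_apply_zero (hp : p ≠ ⊤) (L : ℕ) (T : X →L[ℂ] X)
    (h : lp (fun _ : ℕ => X) p) : relationOperator hp L T h 0 = h 0 := by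
  change h 0 - polyShift X hp L (lpDiag hp T h) 0 = _
  rw [polyShift_apply_zero, sub_zero]

theorem relationOperator_apply_succ (hp : p ≠ ⊤) (L : ℕ) (T : X →L[ℂ] X)
    (h : lp (fun _ : ℕ => X) p) (n : ℕ) : relationOperator hp L T h (n + 1) =
      h (n + 1) - ((((n : ℝ) + 2) / ((n : ℝ) + 1)) ^ L : ℝ) • T (h n) := by
  change h (n + 1) - polyShift X hp L (lpDiag hp T h) (n + 1) = _
  rw [polyShift_apply_succ, lpDiag_apply]

theorem sum_Ico_inv_sq_le_one (N : ℕ) :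
    ∑ m ∈ Finset.Ico 1 N, (((m : ℕ) : ℝ) + 1)⁻¹ ^ 2 ≤ 1 := by
  rcases N with _ | N
  · simp
  have h : ∑ m ∈ Finset.Ico 1 (N + 1), (((m : ℕ) : ℝ) + 1)⁻¹ ^ 2 ≤ 1 - ((N : ℝ) + 1)⁻¹ := by
    induction N with
    | zero => simp
    | succ N ih =>
      rw [Finset.sum_Ico_succ_top (by omega)]
      have h1 : (((N + 1 : ℕ) : ℝ) + 1)⁻¹ ^ 2 ≤ ((N : ℝ) + 1)⁻¹ - (((N + 1 : ℕ) : ℝ) + 1)⁻¹ := by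
        push_cast
        rw [inv_sub_inv (by positivity) (by positivity), inv_pow, inv_eq_one_div]
        gcongr <;> nlinarith [N.cast_nonneg (α := ℝ)]
      linarith
  have : 0 ≤ ((N : ℝ) + 1)⁻¹ := by positivity
  linarith

/-- The distance from a vector in position `0` to the range of the relation operator is bounded
below by the key estimate for the recursion. -/
theorem HasGrowth.exists_le_norm_single_sub {T : X →L[ℂ] X} {M : ℝ} {r : ℕ}
    (hT : HasGrowth T M r) : ∃ L : ℕ, ∀ (p : ℝ≥0∞) [Fact (1 ≤ p)] (hp : p ≠ ⊤) (x : X)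
      (h : lp (fun _ : ℕ => X) p),
      ‖x‖ ≤ 2 * ‖lp.single p 0 x - relationOperator hp L T h‖ ∧
      (p = 1 → ‖x‖ ≤ ‖lp.single p 0 x - relationOperator hp L T h‖) := by
  obtain ⟨L, hL⟩ := hT.exists_norm_le_of_recursion
  refine ⟨L + 2, fun p _ hp x h => ?_⟩
  have hp0 : p ≠ 0 := (one_pos.trans_le Fact.out).ne'
  set G : lp (fun _ : ℕ => X) p := lp.single p 0 x - relationOperator hp (L + 2) T h with hG
  -- `w` removes the weights which `ℓ_p(ℕ, X)` carries implicitly; the exponent exceeds `L` by `2`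
  -- because `∑ (n + 1)⁻²` converges, which handles all `p` at once.
  let w : ℕ → ℝ := fun n => (((n : ℝ) + 1) ^ (L + 2))⁻¹
  have hw : ∀ (n : ℕ) (y : X), ((n : ℝ) + 1) ^ L * ‖w n • y‖ = ((n : ℝ) + 1)⁻¹ ^ 2 * ‖y‖ := by
    intro n y
    rw [norm_smul, Real.norm_of_nonneg (by positivity)]
    simp only [w]
    field_simp
    ring
  have hle : ∀ n : ℕ, ((n : ℝ) + 1)⁻¹ ^ 2 ≤ 1 := fun n =>
    pow_le_one₀ (by positivity) (inv_le_one_of_one_le₀ (by linarith [n.cast_nonneg (α := ℝ)]))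
  have hrec : ∀ n, T (w n • h n) = w (n + 1) • h (n + 1) + w (n + 1) • G (n + 1) := by
    intro n
    have h1 : G (n + 1) = -(h (n + 1) - ((((n : ℝ) + 2) / ((n : ℝ) + 1)) ^ (L + 2) : ℝ) •
        T (h n)) := by
      rw [← relationOperator_apply_succ hp]
      exact (congrArg (· - _) (lp_single_zero_apply_succ (p := p) x n)).trans (zero_sub _)
    rw [h1, ContinuousLinearMap.map_smul_of_tower, ← smul_add, neg_sub, add_sub_cancel, smul_smul]
    congr 1
    simp only [w]
    push_cast
    rw [div_pow, add_assoc, one_add_one_eq_two]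
    field_simp
  have hG0 : G 0 = x - h 0 := by
    rw [← relationOperator_apply_zero hp (L + 2) T h]
    exact congrArg (· - _) (lp_single_zero_apply_zero (p := p) x)
  have hw0 : w 0 = 1 := by simp [w]
  have hx : ‖x‖ ≤ ‖G 0‖ + ‖w 0 • h 0‖ := by
    rw [hG0, hw0, one_smul]
    simpa using norm_add_le (x - h 0) (h 0)
  have main : ∀ B : ℝ, (∀ N, ∑ m ∈ Finset.Ico 1 N, (((m : ℕ) : ℝ) + 1)⁻¹ ^ 2 * ‖G m‖ ≤ B) →
      ‖x‖ ≤ ‖G 0‖ + B := by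
    intro B hB
    refine hx.trans ?_
    gcongr
    refine hL (fun n => w n • h n) (fun n => w n • G n) ‖h‖ B hrec (fun n => ?_) (fun N => ?_)
    · rw [hw]
      calc _ ≤ 1 * ‖h n‖ := by gcongr; exact hle n
        _ ≤ ‖h‖ := by rw [one_mul]; exact lp.norm_apply_le_norm hp0 h n
    · simp_rw [hw]
      exact hB N
  refine ⟨?_, ?_⟩
  · have h1 := main ‖G‖ fun N => by
      calc _ ≤ ∑ m ∈ Finset.Ico 1 N, (((m : ℕ) : ℝ) + 1)⁻¹ ^ 2 * ‖G‖ := by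
            gcongr with m _
            exact lp.norm_apply_le_norm hp0 G m
        _ ≤ 1 * ‖G‖ := by
            rw [← Finset.sum_mul]
            gcongr
            exact sum_Ico_inv_sq_le_one N
        _ = ‖G‖ := one_mul _
    linarith [lp.norm_apply_le_norm hp0 G 0]
  · rintro rfl
    have h1 : ∀ s : Finset ℕ, ∑ m ∈ s, ‖G m‖ ≤ ‖G‖ := by
      intro s
      simpa using lp.sum_rpow_le_norm_rpow (by simp) G s
    have h2 := main (‖G‖ - ‖G 0‖) fun N => by
      calc _ ≤ ∑ m ∈ Finset.Ico 1 N, ‖G m‖ := by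
            gcongr with m _
            exact mul_le_of_le_one_left (norm_nonneg _) (hle m)
        _ ≤ _ := by
            have h3 := h1 (insert 0 (Finset.Ico 1 N))
            rw [Finset.sum_insert (by simp)] at h3
            linarith
    linarith

/-- An operator of polynomial growth extends to an invertible operator on a quotient of `ℓ_p(ℕ, X)`
whose powers grow polynomially in both directions and whose spectrum is the approximate point
spectrum of the given operator. -/
theorem HasGrowth.exists_scalar_extension [CompleteSpace X] {T : X →L[ℂ] X} {M : ℝ} {r : ℕ}
    (hT : HasGrowth T M r) (hp : p ≠ ⊤) :
    ∃ (N : Submodule ℂ (lp (fun _ : ℕ => X) p)) (_ : IsClosed (N : Set (lp (fun _ : ℕ => X) p)))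
      (S : ClosedQuotient N →L[ℂ] ClosedQuotient N) (π : X →L[ℂ] ClosedQuotient N),
      IsUnit S ∧ IsETScalar S ∧ spectrum ℂ S = approxPointSpectrum T ∧
        (∀ x, S (π x) = π (T x)) ∧ (∀ x, ‖x‖ ≤ 2 * ‖π x‖) ∧ (p = 1 → ∀ x, ‖π x‖ = ‖x‖) := by
  obtain ⟨L, hL⟩ := hT.exists_le_norm_single_sub
  let N := (relationOperator (p := p) hp L T).range.topologicalClosure
  have hD : ∀ {A : X →L[ℂ] X}, A * T = T * A → ∀ x ∈ N, lpDiag hp A x ∈ N := fun hA =>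
    mem_closure_range_of_commute (commute_lpDiag_relationOperator hp L hA)
  have hTn : ∀ n : ℕ, ‖T ^ n‖ ≤ M * ((n : ℝ) + 1) ^ r := fun n =>
    ContinuousLinearMap.opNorm_le_bound _ (by have := hT.one_le; positivity) (hT.upper n)
  have hmono : ∀ (n : ℕ) {C : ℝ} {k : ℕ}, C ≤ M → k ≤ r + L →
      C * ((n : ℝ) + 1) ^ k ≤ M * ((n : ℝ) + 1) ^ (r + L) := by
    intro n C k hC hk
    have := hT.one_le
    gcongr
    linarith [n.cast_nonneg (α := ℝ)]
  obtain ⟨hunit, hscalar, hout⟩ := isETScalar_quotientOperator (hD rfl)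
    (mem_closure_range_of_commute (commute_polyShift_relationOperator hp L T))
    (lpDiag_mul_polyShift hp L T)
    (fun f => Submodule.le_topologicalClosure _ ⟨f, rfl⟩)
    (fun n => (norm_lpDiag_pow_le hp T n).trans ((hTn n).trans (hmono n le_rfl (by omega))))
    (fun n => (norm_polyShift_pow_le hp L n).trans
      ((one_mul _).symm.trans_le (hmono n hT.one_le (by omega))))
  let π : X →L[ℂ] ClosedQuotient N :=
    (ClosedQuotient.mk N).comp (lp.singleContinuousLinearMap ℂ (fun _ : ℕ => X) p 0)
  have hπ : ∀ x, π x = ClosedQuotient.mk N (lp.single p 0 x) := fun x => rfl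
  have hST : ∀ x, quotientOperator N (lpDiag hp T) (hD rfl) (π x) = π (T x) := fun x =>
    congrArg (ClosedQuotient.mk N) (lpDiag_single hp T x)
  have hlow : ∀ x, ‖x‖ ≤ 2 * ‖π x‖ := by
    intro x
    rw [hπ]
    have h1 : ‖x‖ / 2 ≤ ‖ClosedQuotient.mk N (lp.single p 0 x)‖ :=
      le_norm_mk_closure_range fun h => by linarith [(hL p hp x h).1]
    linarith
  refine ⟨N, inferInstance, _, π, hunit, hscalar, ?_, hST, hlow, fun hp1 x => ?_⟩
  · refine Set.Subset.antisymm (fun z hz => ?_)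
      (approxPointSpectrum_subset_spectrum_of_intertwining π hlow hST)
    by_contra hzT
    have hz1 : 1 ≤ ‖z‖ := hout z hz
    have hu := notMem_spectrum_of_notMem_approxPointSpectrum hTn hz1 hzT
    rw [spectrum.notMem_iff] at hu
    obtain ⟨U, hU⟩ := hu
    rw [Algebra.algebraMap_eq_smul_one] at hU
    set Q : X →L[ℂ] X := ((U⁻¹ : (X →L[ℂ] X)ˣ) : X →L[ℂ] X) with hQ
    have hTU : T = z • 1 - U := by rw [hU, sub_sub_cancel]
    have hQT : Q * T = T * Q := by
      rw [hTU, mul_sub, sub_mul, U.inv_mul, U.mul_inv, mul_smul_comm, smul_mul_assoc, mul_one,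
        one_mul]
    refine notMem_spectrum_quotientOperator (hD rfl) (hD hQT) ?_ ?_ hz
    · rw [← lpDiag_smul_one_sub, ← lpDiag_mul, ← hU, U.inv_mul, lpDiag_one]
    · rw [← lpDiag_smul_one_sub, ← lpDiag_mul, ← hU, U.mul_inv, lpDiag_one]
  · rw [hπ]
    refine le_antisymm ?_ (le_norm_mk_closure_range fun h => (hL p hp x h).2 hp1)
    have h1 : ‖(lp.single p 0 x : lp (fun _ : ℕ => X) p)‖ = ‖x‖ :=
      lp.norm_single (E := fun _ : ℕ => X) (one_pos.trans_le Fact.out) 0 x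
    rw [← h1]
    exact ClosedQuotient.norm_mk_le _

end Extension

/-! ### Quotients of `ℓ_p(ℕ, X)` are `SQ_p(X)`-spaces -/

section LpCount

variable {X : Type u} [NormedAddCommGroup X] {p : ℝ≥0∞}

instance measurableSingletonClass_uliftNat : MeasurableSingletonClass (ULift.{u} ℕ) :=
  ⟨fun _ => measurableSet_preimage_up.1 trivial⟩

theorem lintegral_enorm_rpow_count (f : ULift.{u} ℕ → X) :
    ∫⁻ i, ‖f i‖ₑ ^ p.toReal ∂Measure.count = ∑' n : ℕ, ENNReal.ofReal (‖f ⟨n⟩‖ ^ p.toReal) := by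
  rw [lintegral_count, ← Equiv.ulift.symm.tsum_eq]
  refine tsum_congr fun n => ?_
  rw [← ENNReal.ofReal_rpow_of_nonneg (norm_nonneg _) ENNReal.toReal_nonneg, ofReal_norm]
  rfl

variable [Fact (1 ≤ p)]

theorem eLpNorm_count_lp (hp : p ≠ ⊤) (f : lp (fun _ : ℕ => X) p) :
    eLpNorm (fun i : ULift.{u} ℕ => f i.down) p Measure.count = ENNReal.ofReal ‖f‖ := by
  have hp0 := toReal_pos_of_one_le hp
  rw [eLpNorm_eq_lintegral_rpow_enorm_toReal (one_pos.trans_le Fact.out).ne' hp,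
    lintegral_enorm_rpow_count (fun i : ULift.{u} ℕ => f i.down),
    ← ENNReal.ofReal_tsum_of_nonneg (fun n => by positivity)
      ((memℓp_gen_iff hp0).1 (lp.memℓp f)),
    lp.norm_eq_tsum_rpow hp0, ENNReal.ofReal_rpow_of_nonneg (tsum_nonneg fun n => by positivity)
      (by positivity)]

theorem memLp_count_lp (hp : p ≠ ⊤) (f : lp (fun _ : ℕ => X) p) :
    MemLp (fun i : ULift.{u} ℕ => f i.down) p Measure.count :=
  ⟨(StronglyMeasurable.of_discrete).aestronglyMeasurable, by
    rw [eLpNorm_count_lp hp]; exact ENNReal.ofReal_lt_top⟩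

theorem memℓp_of_memLp_count (hp : p ≠ ⊤) {g : ULift.{u} ℕ → X} (hg : MemLp g p Measure.count) :
    Memℓp (fun n : ℕ => g ⟨n⟩) p := by
  refine memℓp_gen ?_
  have h := lintegral_rpow_enorm_lt_top_of_eLpNorm_lt_top (one_pos.trans_le Fact.out).ne' hp hg.2
  rw [lintegral_enorm_rpow_count] at h
  refine (ENNReal.summable_toReal h.ne).congr fun n => ?_
  rw [ENNReal.toReal_ofReal (by positivity)]

variable [NormedSpace ℂ X]

/-- The space `ℓ_p(ℕ, X)` as the space `L_p` of the counting measure. -/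
noncomputable def lpEquivLpCount (X : Type u) [NormedAddCommGroup X] [NormedSpace ℂ X]
    (hp : p ≠ ⊤) : lp (fun _ : ℕ => X) p ≃ₗᵢ[ℂ] Lp X p (Measure.count : Measure (ULift.{u} ℕ)) :=
  LinearIsometryEquiv.ofSurjective
    { toFun := fun f => (memLp_count_lp hp f).toLp _
      map_add' := fun f g => MemLp.toLp_add (memLp_count_lp hp f) (memLp_count_lp hp g)
      map_smul' := fun c f => MemLp.toLp_const_smul c (memLp_count_lp hp f)
      norm_map' := fun f => by
        change ‖(memLp_count_lp hp f).toLp _‖ = _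
        rw [Lp.norm_toLp, eLpNorm_count_lp hp, ENNReal.toReal_ofReal (norm_nonneg _)] }
    (fun g => ⟨⟨fun n => g ⟨n⟩, memℓp_of_memLp_count hp (Lp.memLp g)⟩,
      Lp.toLp_coeFn g (Lp.memLp g)⟩)

end LpCount

section TrivialUltraproduct

variable {E : Type u} [NormedAddCommGroup E]

theorem mem_ultraNull_pure [NormedSpace ℂ E] {x : lp (fun _ : PUnit.{u + 1} => E) ⊤} :
    x ∈ ultraNull (fun _ : PUnit.{u + 1} => E) (pure PUnit.unit) ↔ x PUnit.unit = 0 := by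
  change Tendsto (fun i => ‖x i‖) ((pure PUnit.unit : Ultrafilter PUnit.{u + 1}) : Filter _) (𝓝 0)
    ↔ _
  rw [Ultrafilter.coe_pure, tendsto_pure_left]
  constructor
  · intro h
    by_contra hx
    exact lt_irrefl ‖x PUnit.unit‖ (h (Set.Iio ‖x PUnit.unit‖) (Iio_mem_nhds (norm_pos_iff.2 hx)))
  · intro h s hs
    rw [h, norm_zero]
    exact mem_of_mem_nhds hs

/-- The constant family indexed by a point. -/
noncomputable def constFamily (x : E) : lp (fun _ : PUnit.{u + 1} => E) ⊤ :=
  ⟨fun _ => x, memℓp_infty ⟨‖x‖, by rintro _ ⟨i, rfl⟩; exact le_rfl⟩⟩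

theorem norm_constFamily (x : E) : ‖constFamily x‖ = ‖x‖ :=
  le_antisymm (lp.norm_le_of_forall_le (norm_nonneg _) fun _ => le_rfl)
    (lp.norm_apply_le_norm ENNReal.top_ne_zero (constFamily x) PUnit.unit)

/-- A Banach space is the ultraproduct of itself over a one-point index set. -/
noncomputable def equivTrivialUltraproduct (E : Type u) [NormedAddCommGroup E] [NormedSpace ℂ E] :
    E ≃ₗᵢ[ℂ] BanachUltraproduct (fun _ : PUnit.{u + 1} => E) (pure PUnit.unit) :=
  LinearIsometryEquiv.ofSurjective
    { toFun := fun x => Submodule.Quotient.mk (constFamily x)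
      map_add' := fun x y => rfl
      map_smul' := fun c x => rfl
      norm_map' := fun x => by
        refine le_antisymm ((Submodule.Quotient.norm_mk_le _ _).trans_eq (norm_constFamily x)) ?_
        refine le_of_forall_pos_le_add fun ε hε => ?_
        obtain ⟨y, hy, hlt⟩ := Submodule.Quotient.norm_mk_lt
          (Submodule.Quotient.mk (constFamily x) :
            BanachUltraproduct (fun _ : PUnit.{u + 1} => E) (pure PUnit.unit)) hε
        have h1 := mem_ultraNull_pure.1 ((Submodule.Quotient.eq _).1 hy)
        have h2 : y PUnit.unit = x := sub_eq_zero.1 h1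
        refine (congrArg norm h2).symm.trans_le ?_
        exact (lp.norm_apply_le_norm ENNReal.top_ne_zero y PUnit.unit).trans hlt.le }
    (fun y => by
      obtain ⟨f, rfl⟩ := Submodule.Quotient.mk_surjective _ y
      exact ⟨f PUnit.unit, (Submodule.Quotient.eq _).2 (mem_ultraNull_pure.2 (sub_self _))⟩)

end TrivialUltraproduct

/-- An isometric isomorphism induces an isometric isomorphism of quotients. -/
noncomputable def closedQuotientEquiv {E F : Type*} [NormedAddCommGroup E] [NormedSpace ℂ E]
    [SeminormedAddCommGroup F] [NormedSpace ℂ F] (e : E ≃ₗᵢ[ℂ] F) (N : Submodule ℂ E)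
    [IsClosed (N : Set E)] : ClosedQuotient N ≃ₗᵢ[ℂ] (F ⧸ N.map (e.toLinearEquiv : E →ₗ[ℂ] F)) where
  toLinearEquiv := Submodule.Quotient.equiv N _ e.toLinearEquiv rfl
  norm_map' := fun y => by
    obtain ⟨x, rfl⟩ := ClosedQuotient.mk_surjective y
    change ‖(Submodule.Quotient.mk (e x) : F ⧸ N.map (e.toLinearEquiv : E →ₗ[ℂ] F))‖ = _
    refine le_antisymm ?_ ?_
    · refine le_of_forall_pos_le_add fun ε hε => ?_
      obtain ⟨x', hx', hlt⟩ := ClosedQuotient.exists_norm_lt (ClosedQuotient.mk N x) hε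
      have h : (Submodule.Quotient.mk (e x) : F ⧸ N.map (e.toLinearEquiv : E →ₗ[ℂ] F)) =
          Submodule.Quotient.mk (e x') := by
        rw [Submodule.Quotient.eq, ← map_sub]
        exact ⟨x - x', ClosedQuotient.mk_eq_mk.1 hx'.symm, rfl⟩
      rw [h]
      refine (Submodule.Quotient.norm_mk_le _ _).trans ?_
      rw [e.norm_map]
      exact hlt.le
    · refine le_of_forall_pos_le_add fun ε hε => ?_
      obtain ⟨z, hz, hlt⟩ := Submodule.Quotient.norm_mk_lt
        (Submodule.Quotient.mk (e x) : F ⧸ N.map (e.toLinearEquiv : E →ₗ[ℂ] F)) hε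
      obtain ⟨x', rfl⟩ := e.surjective z
      rw [Submodule.Quotient.eq, ← map_sub] at hz
      obtain ⟨w, hw, hwe⟩ := hz
      have h1 : w = x' - x := e.injective hwe
      have h2 : ClosedQuotient.mk N x = ClosedQuotient.mk N x' := by
        rw [eq_comm, ClosedQuotient.mk_eq_mk, ← h1]
        exact hw
      rw [h2]
      refine (ClosedQuotient.norm_mk_le _).trans ?_
      rw [e.norm_map] at hlt
      exact hlt.le

theorem exists_closedQuotient_equiv {E F : Type*} [NormedAddCommGroup E] [NormedSpace ℂ E]
    [SeminormedAddCommGroup F] [NormedSpace ℂ F] (e : E ≃ₗᵢ[ℂ] F) (N : Submodule ℂ E)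
    [hN : IsClosed (N : Set E)] : ∃ (G : Submodule ℂ F) (N' : Submodule ℂ G),
      IsClosed (G : Set F) ∧ IsClosed (N' : Set G) ∧ Nonempty (ClosedQuotient N ≃ₗᵢ[ℂ] (G ⧸ N')) := by
  let e' : E ≃ₗᵢ[ℂ] (⊤ : Submodule ℂ F) := e.trans (LinearIsometryEquiv.ofTop F ⊤ rfl).symm
  exact ⟨⊤, N.map (e'.toLinearEquiv : E →ₗ[ℂ] (⊤ : Submodule ℂ F)), isClosed_univ,
    e'.toHomeomorph.isClosed_image.2 hN, ⟨closedQuotientEquiv e' N⟩⟩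

theorem isSQpSpace_closedQuotient {X : Type u} [NormedAddCommGroup X] [NormedSpace ℂ X]
    {p : ℝ≥0∞} [Fact (1 ≤ p)] (hp : p ≠ ⊤) (N : Submodule ℂ (lp (fun _ : ℕ => X) p))
    [IsClosed (N : Set (lp (fun _ : ℕ => X) p))] : IsSQpSpace p X (ClosedQuotient N) :=
  ⟨PUnit, pure PUnit.unit, fun _ => ULift ℕ, fun _ => inferInstance, fun _ => Measure.count,
    exists_closedQuotient_equiv
      ((lpEquivLpCount X hp).trans (equivTrivialUltraproduct _)) N⟩

/-! ### Similarity and Hilbert space extensions -/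

section Similarity

variable {X Y Z : Type*} [NormedAddCommGroup X] [NormedSpace ℂ X] [NormedAddCommGroup Y]
  [NormedSpace ℂ Y] [NormedAddCommGroup Z] [NormedSpace ℂ Z]

theorem isSimilarToRestriction_of_intertwining [CompleteSpace X] [CompleteSpace Y] {T : X →L[ℂ] X}
    {S : Y →L[ℂ] Y} (π : X →L[ℂ] Y) {c : ℝ} (hc : 0 ≤ c) (hπ : ∀ x, ‖x‖ ≤ c * ‖π x‖)
    (hST : ∀ x, S (π x) = π (T x)) : IsSimilarToRestriction T S := by
  have hanti : AntilipschitzWith ⟨c, hc⟩ π := π.antilipschitz_of_bound hπ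
  have hcl : IsClosed (Set.range π) := hanti.isClosed_range π.uniformContinuous
  refine ⟨π.range, ?_, by rwa [LinearMap.coe_range], π.equivRange hanti.injective hcl, fun x => ?_⟩
  · rintro _ ⟨x, rfl⟩
    exact ⟨T x, (hST x).symm⟩
  · apply Subtype.ext
    exact (hST x).symm

theorem IsETScalar.conj {S : Y →L[ℂ] Y} (hS : IsETScalar S) (e : Y ≃L[ℂ] Z) :
    IsETScalar (e.conjContinuousAlgEquiv S) := by
  obtain ⟨Φ, hΦ, rfl⟩ := hS
  exact ⟨(e.conjContinuousAlgEquiv : (Y →L[ℂ] Y) →ₐ[ℂ] (Z →L[ℂ] Z)).comp Φ,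
    e.conjContinuousAlgEquiv.continuous.comp hΦ, rfl⟩

end Similarity

section Hilbert

variable {H K : Type u} [NormedAddCommGroup H] [InnerProductSpace ℂ H] [CompleteSpace H]
  [NormedAddCommGroup K] [InnerProductSpace ℂ K] [CompleteSpace K]

/-- If `π : H → K` is bounded below, then `K` has an equivalent Hilbert space norm for which `π` is
isometric: that of the orthogonal sum of `H` and the orthogonal complement of the range. -/
theorem exists_hilbert_renorming (π : H →L[ℂ] K) {c : ℝ} (hc : 0 ≤ c)
    (hπ : ∀ x, ‖x‖ ≤ c * ‖π x‖) :
    ∃ e : WithLp 2 (H × (π.rangeᗮ : Submodule ℂ K)) ≃L[ℂ] K,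
      ∀ h, e (WithLp.toLp 2 (h, 0)) = π h := by
  have hanti : AntilipschitzWith ⟨c, hc⟩ π := π.antilipschitz_of_bound hπ
  have hcl : IsClosed (π.range : Set K) := by
    rw [LinearMap.coe_range]
    exact hanti.isClosed_range π.uniformContinuous
  have : CompleteSpace π.range := hcl.completeSpace_coe
  let A : H × (π.rangeᗮ : Submodule ℂ K) →L[ℂ] K := π.coprod (π.rangeᗮ).subtypeL
  have hker : A.ker = ⊥ := by
    rw [LinearMap.ker_eq_bot']
    rintro ⟨h, m⟩ hm
    have h1 : π h + (m : K) = 0 := hm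
    have h2 : (m : K) ∈ π.range := ⟨-h, by
      rw [map_neg]
      exact neg_eq_of_add_eq_zero_right h1⟩
    have h3 : (m : K) = 0 := by
      have := Submodule.inner_right_of_mem_orthogonal h2 m.2
      exact inner_self_eq_zero.1 this
    rw [h3, add_zero] at h1
    exact Prod.ext (hanti.injective (h1.trans (map_zero π).symm)) (Subtype.ext h3)
  have hrange : A.range = ⊤ := by
    rw [LinearMap.range_eq_top]
    intro k
    obtain ⟨y, ⟨h, hy⟩, z, hz, hk⟩ := π.range.exists_add_mem_mem_orthogonal k
    refine ⟨(h, ⟨z, hz⟩), ?_⟩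
    rw [hk, ← hy]
    rfl
  refine ⟨(WithLp.prodContinuousLinearEquiv 2 ℂ H _).trans
    (ContinuousLinearEquiv.ofBijective A hker hrange), fun h => ?_⟩
  change A (h, 0) = π h
  exact add_zero _

/-- The quotient of a Hilbert space by a closed subspace, as the orthogonal complement. -/
noncomputable def closedQuotientEquivOrthogonal (N : Submodule ℂ K) [hN : IsClosed (N : Set K)] :
    ClosedQuotient N ≃L[ℂ] Nᗮ :=
  haveI : CompleteSpace N := hN.completeSpace_coe
  LinearIsometryEquiv.toContinuousLinearEquiv (E := ClosedQuotient N)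
    { toLinearEquiv := (Submodule.quotientEquivOrthogonal (𝕜 := ℂ) N).toLinearEquiv
      norm_map' := (Submodule.quotientEquivOrthogonal (𝕜 := ℂ) N).norm_map }

theorem exists_hilbert_extension {T : H →L[ℂ] H} {Y : Type*} [NormedAddCommGroup Y]
    [NormedSpace ℂ Y] {S : Y →L[ℂ] Y} (hS : IsETScalar S) (e : Y ≃L[ℂ] K) (π : H →L[ℂ] Y) {c : ℝ}
    (hc : 0 ≤ c) (hπ : ∀ x, ‖x‖ ≤ c * ‖π x‖) (hST : ∀ x, S (π x) = π (T x)) :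
    ∃ (K' : Type u) (_ : NormedAddCommGroup K') (_ : InnerProductSpace ℂ K') (_ : CompleteSpace K')
      (S' : K' →L[ℂ] K'), IsETScalar S' ∧ IsExtensionOf S' T ∧ spectrum ℂ S' = spectrum ℂ S := by
  obtain ⟨f, hf⟩ := exists_hilbert_renorming ((e : Y →L[ℂ] K).comp π)
    (c := c * ‖(e.symm : K →L[ℂ] Y)‖) (by positivity) (fun x => by
      rw [mul_assoc]
      refine (hπ x).trans ?_
      gcongr
      simpa using (e.symm : K →L[ℂ] Y).le_opNorm (e (π x)))
  let g := e.trans f.symm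
  have hg : ∀ h, g (π h) = WithLp.toLp 2 (h, 0) := fun h => by
    refine f.injective ?_
    rw [hf]
    exact f.apply_symm_apply _
  refine ⟨_, inferInstance, inferInstance, inferInstance, g.conjContinuousAlgEquiv S, hS.conj g,
    ⟨⟨((g : Y →L[ℂ] _).comp π).toLinearMap, fun h => ?_⟩, fun h => ?_⟩, ?_⟩
  · change ‖g (π h)‖ = ‖h‖
    rw [hg, WithLp.norm_toLp_fst]
  · change g (S (g.symm (g (π h)))) = g (π (T h))
    rw [g.symm_apply_apply, hST]
  · exact AlgEquiv.spectrum_eq g.conjContinuousAlgEquiv S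

end Hilbert

theorem theorem4p1 :
    (∀ (X : Type u) [NormedAddCommGroup X] [NormedSpace ℂ X] [CompleteSpace X] (T : X →L[ℂ] X),
      (IsETSubscalar T ↔ PolynomialGrowth T) ∧
      (PolynomialGrowth T → ∀ (p : ℝ≥0∞) [Fact (1 ≤ p)], p ≠ ⊤ →
        ∃ (Y : Type u) (_ : NormedAddCommGroup Y) (_ : NormedSpace ℂ Y) (_ : CompleteSpace Y)
          (S : Y →L[ℂ] Y),
          IsSQpSpace p X Y ∧ IsUnit S ∧ IsETScalar S ∧ IsSimilarToRestriction T S ∧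
            spectrum ℂ S = approxPointSpectrum T ∧ (p = 1 → IsExtensionOf S T))) ∧
    (∀ (H : Type u) [NormedAddCommGroup H] [InnerProductSpace ℂ H] [CompleteSpace H]
      (T : H →L[ℂ] H), PolynomialGrowth T →
        ∃ (K : Type u) (_ : NormedAddCommGroup K) (_ : InnerProductSpace ℂ K)
          (_ : CompleteSpace K) (S : K →L[ℂ] K),
          IsETScalar S ∧ IsExtensionOf S T ∧ spectrum ℂ S = approxPointSpectrum T) := by
  have key : ∀ (X : Type u) [NormedAddCommGroup X] [NormedSpace ℂ X] [CompleteSpace X]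
      (T : X →L[ℂ] X), PolynomialGrowth T → ∀ (p : ℝ≥0∞) [Fact (1 ≤ p)], p ≠ ⊤ →
        ∃ (Y : Type u) (_ : NormedAddCommGroup Y) (_ : NormedSpace ℂ Y) (_ : CompleteSpace Y)
          (S : Y →L[ℂ] Y),
          IsSQpSpace p X Y ∧ IsUnit S ∧ IsETScalar S ∧ IsSimilarToRestriction T S ∧
            spectrum ℂ S = approxPointSpectrum T ∧ (p = 1 → IsExtensionOf S T) := by
    intro X _ _ _ T hT p _ hp
    obtain ⟨M, r, hT⟩ := hT.exists_hasGrowth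
    obtain ⟨N, hN, S, π, hu, hS, hσ, hST, hπ, hπ1⟩ := hT.exists_scalar_extension (p := p) hp
    exact ⟨ClosedQuotient N, inferInstance, inferInstance, inferInstance, S,
      isSQpSpace_closedQuotient hp N, hu, hS,
      isSimilarToRestriction_of_intertwining π zero_le_two hπ hST, hσ,
      fun hp1 => ⟨⟨π.toLinearMap, hπ1 hp1⟩, hST⟩⟩
  refine ⟨fun X _ _ _ T => ⟨⟨IsETSubscalar.polynomialGrowth, fun hT => ?_⟩, key X T⟩,
    fun H _ _ _ T hT => ?_⟩
  · obtain ⟨Y, i₁, i₂, i₃, S, -, -, hS, hTS, -⟩ := key X T hT 1 ENNReal.one_ne_top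
    exact ⟨Y, i₁, i₂, i₃, S, hS, hTS⟩
  · obtain ⟨M, r, hT⟩ := hT.exists_hasGrowth
    obtain ⟨N, hN, S, π, -, hS, hσ, hST, hπ, -⟩ :=
      hT.exists_scalar_extension (p := 2) ENNReal.ofNat_ne_top
    obtain ⟨K', i₁, i₂, i₃, S', hS', hext, hspec⟩ :=
      exists_hilbert_extension hS (closedQuotientEquivOrthogonal N) π zero_le_two hπ hST
    exact ⟨K', i₁, i₂, i₃, S', hS', hext, hspec.trans hσ⟩
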